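/- Let $n\ge 2$, $\alpha=e^{2\pi i/n}$, $a=\mathrm{diag}(1,\alpha,\dots,\alpha^{n-1})$, and let $\tau$ be the permutation matrix with $\tau e_i=e_{i+1}$ (indices mod $n$). Put $\mathcal G_0=\{y\in gl(n,\mathbb C):\tau^{-1}y\tau=y\}$, $sl(n)_a=\{y\in sl(n,\mathbb C):[a,y]=0\}$, and let $sl(n)_a^\perp$ be the orthogonal complement of $sl(n)_a$ in $sl(n,\mathbb C)$ with respect to the form $\mathrm{tr}(xy)$. For a smooth matrix function $u(x,t)$ with values in $sl(n)_a^\perp$, let $Q_{a,j}(u)$ be the polynomial differential operators (in $x$) of the $sl(n,\mathbb C)$-hierarchy: $Q_{a,0}=a$, the off-diagonal part of $Q_{a,j+1}(u)$ is determined by $(Q_{a,j}(u))_x+[u,Q_{a,j}(u)]=[Q_{a,j+1}(u),a]$, and its diagonal part by the coefficient of $\lambda^{-(j+1)}$ in $\bigl(a+\sum_{i\ge1}Q_{a,i}(u)\lambda^{-i}\bigr)^n=I$. For an open set $\mathcal O\subset\mathbb R^2$, a solution of the Kupershmidt–Wilson (KW) equation on $\mathcal O$ is a smooth map $u:\mathcal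 O\to\mathcal G_0\cap sl(n)_a^\perp$ with $$u_t=(Q_{a,n+1}(u))_x+[u,Q_{a,n+1}(u)].$$ If $(0,0)\in\mathcal O$, a trivialization of $u$ normalized at $(0,0)$ is a map $E(x,t,\lambda)$, $(x,t)\in\mathcal O$, $\lambda\in\mathbb C$, smooth in $(x,t)$, such that for all $\lambda\in\mathbb C$ $$E_x=E(a\lambda+u),\qquad E_t=E\sum_{j=0}^{n+1}Q_{a,j}(u)\lambda^{n+1-j},\qquad E(0,0,\lambda)=I.$$ For $w\in\mathbb C^n$ let $B(w)$ be the $n\times n$ matrix with columns $w,\tau^{-1}w,\dots,\tau^{-(n-1)}w$, and, if $B(w)$ is nonsingular, put $p_{w,k}(\lambda)=a\lambda-kaB(w)aB(w)^{-1}$. **Theorem.** Let $\mathcal O_1\subset\mathbb R^2$ be a connected open set containing $(0,0)$, $u$ a solution of the KW equation on $\mathcal O_1$, $E$ a trivialization of $u$ on $\mathcal O_1$ normalized at $(0,0)$, $v\in\mathbb C^n$ with $B(v)$ nonsingular, and $k\in\mathbb C$, $k\ne0$. Then $E(x,t,k)$ is invertible for every $(x,t)\in\mathcal O_1$. Put $\tilde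 v(x,t)=E(x,t,k)^{-1}v$ and $\mathcal O=\{(x,t)\in\mathcal O_1: B(\tilde v(x,t))\text{ is nonsingular}\}$. Then $\mathcal O$ is open and contains $(0,0)$. On $\mathcal O$ put $$\tilde Y=-kaB(\tilde v)aB(\tilde v)^{-1},\qquad \tilde u=aua^{-1}+[\tilde Y,a]a^{-1}.$$ 1. $\tilde u$ is a solution of the KW equation on $\mathcal O$. 2. $\tilde E(x,t,\lambda)=p_{v,k}(\lambda)E(x,t,\lambda)p_{\tilde v(x,t),k}(\lambda)^{-1}$, defined for $(x,t)\in\mathcal O$ and $\lambda^n\ne k^n$, extends to a map on $\mathcal O\times\mathbb C$ which has values in $GL(n,\mathbb C)$, is holomorphic in $\lambda\in\mathbb C$, and is a trivialization of $\tilde u$ on $\mathcal O$ normalized at $(0,0)$. 3. $Y=\tilde Y$ is smooth on $\mathcal O$ and solves $$\begin{cases}Y_x=Yu-(aua^{-1}+[Y,a]a^{-1})Y,\\ Y_t=Y\,Q_{a,n+1}(u)-Q_{a,n+1}(aua^{-1}+[Y,a]a^{-1})\,Y,\\ \tau^{-1}Y\tau=Y.\end{cases}$$ -/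

import Mathlib

open Matrix
open scoped ContDiff

noncomputable section

/- The matrix space is finite dimensional, so smoothness and derivatives do not depend on the
norm; we fix the operator norm coming from the sup norm. -/
attribute [local instance] Matrix.linftyOpNormedRing Matrix.linftyOpNormedAlgebra

namespace KW

/-- Complex `n × n` matrices. -/
abbrev Mat (n : ℕ) : Type := Matrix (Fin n) (Fin n) ℂ

/-- The primitive root of unity `α = exp (2πi / n)`. -/
def root (n : ℕ) : ℂ := Complex.exp (2 * (Real.pi : ℂ) * Complex.I / (n : ℂ))

/-- `a = diag (1, α, …, α ^ (n-1))`. -/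
def aMat (n : ℕ) : Mat n := Matrix.diagonal fun i => root n ^ (i : ℕ)

/-- The matrix `τ` of the cyclic permutation `(1 2 ⋯ n)`: `τ e_i = e_{i+1}`, indices mod `n`. -/
def tau (n : ℕ) : Mat n := Matrix.of fun i j => if i = finRotate n j then 1 else 0

/-- `𝒢_k`: the eigenspace of `y ↦ τ⁻¹ y τ` with eigenvalue `α ^ k`. -/
def eigSpace (n k : ℕ) : Set (Mat n) :=
  {y | (tau n)⁻¹ * y * tau n = root n ^ k • y}

/-- `sl(n)_a`: the centralizer of `a` in `sl(n, ℂ)`. -/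
def slCent (n : ℕ) : Set (Mat n) :=
  {y | y.trace = 0 ∧ aMat n * y - y * aMat n = 0}

/-- `sl(n)_a^⊥`: the orthogonal complement in `sl(n, ℂ)`, for the trace form, of `sl(n)_a`. -/
def slPerp (n : ℕ) : Set (Mat n) :=
  {y | y.trace = 0 ∧ ∀ b ∈ slCent n, (b * y).trace = 0}

/-- The `x`-derivative of a matrix valued function of `(x, t)`. -/
def dx {n : ℕ} (f : ℝ × ℝ → Mat n) (p : ℝ × ℝ) : Mat n := deriv (fun s : ℝ => f (s, p.2)) p.1

/-- The `t`-derivative of a matrix valued function of `(x, t)`. -/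
def dt {n : ℕ} (f : ℝ × ℝ → Mat n) (p : ℝ × ℝ) : Mat n := deriv (fun s : ℝ => f (p.1, s)) p.2

/-- The polynomial differential operators `Q_{a,j}` of the `sl(n, ℂ)`-hierarchy, `Q_{a,0} = a`.
The off-diagonal part of `Q_{a,j+1}(u)` is determined by
`(Q_{a,j}(u))_x + [u, Q_{a,j}(u)] = [Q_{a,j+1}(u), a]`. Its diagonal part `T` is determined by
the coefficient of `λ ^ (-(j+1))` in `(a + Q_{a,1} λ⁻¹ + Q_{a,2} λ⁻² + ⋯) ^ n = 1`
(`z ^ n - 1` is the minimal polynomial of `a`). With `S` the contribution of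
`Q_{a,0}, …, Q_{a,j}` to that coefficient, the diagonal part of this equation is
`n a ^ (n-1) T + diag S = 0`, that is, `T = - a (diag S) / n`.
The formal variable `λ⁻¹` is the polynomial variable `X` below. -/
def Q {n : ℕ} (u : ℝ × ℝ → Mat n) : ℕ → ℝ × ℝ → Mat n
  | 0 => fun _ => aMat n
  | j + 1 => fun p =>
      let R : Mat n := dx (Q u j) p + (u p * Q u j p - Q u j p * u p)
      let S : Mat n :=
        ((∑ i : Fin (j + 1), Polynomial.monomial (i : ℕ) (Q u (i : ℕ) p)) ^ n).coeff (j + 1)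
      Matrix.of fun r s =>
        if r = s then -(aMat n r r * S r r) / (n : ℂ)
        else R r s / (aMat n s s - aMat n r r)
  termination_by j => j
  decreasing_by
    all_goals first | exact i.isLt | exact Nat.lt_succ_self _

/-- `u : O → 𝒢_0 ∩ sl(n)_a^⊥` is a smooth solution of the Kupershmidt–Wilson equation
`u_t = (Q_{a,n+1}(u))_x + [u, Q_{a,n+1}(u)]`, the `(n+1)`-th flow defined by `a`. -/
structure IsSolution (n : ℕ) (O : Set (ℝ × ℝ)) (u : ℝ × ℝ → Mat n) : Prop where
  smooth : ContDiffOn ℝ ∞ u O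
  mem : ∀ p ∈ O, u p ∈ eigSpace n 0 ∩ slPerp n
  eqn : ∀ p ∈ O, dt u p = dx (Q u (n + 1)) p + (u p * Q u (n + 1) p - Q u (n + 1) p * u p)

/-- `E` is a trivialization of `u` over `O` normalized at `(0,0)`: for every `λ`, `E(·, λ)` is a
smooth solution of `E_x = E (a λ + u)`,
`E_t = E (a λ^{n+1} + Q_{a,1}(u) λ^n + ⋯ + Q_{a,n+1}(u))`, `E(0,0,λ) = 1`. -/
structure IsTrivialization (n : ℕ) (O : Set (ℝ × ℝ)) (u : ℝ × ℝ → Mat n)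
    (E : ℝ × ℝ → ℂ → Mat n) : Prop where
  smooth : ∀ z : ℂ, ContDiffOn ℝ ∞ (fun p => E p z) O
  eqn_x : ∀ z : ℂ, ∀ p ∈ O, dx (fun q => E q z) p = E p z * (z • aMat n + u p)
  eqn_t : ∀ z : ℂ, ∀ p ∈ O, dt (fun q => E q z) p =
    E p z * ∑ j ∈ Finset.range (n + 2), z ^ (n + 1 - j) • Q u j p
  normalized : ∀ z : ℂ, E (0, 0) z = 1

/-- `B(v)`: the matrix with columns `v, τ⁻¹ v, …, τ^{-(n-1)} v`. -/
def B {n : ℕ} (v : Fin n → ℂ) : Mat n :=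
  Matrix.of fun i j => (((tau n)⁻¹ ^ (j : ℕ)) *ᵥ v) i

/-- `-k a B(v) a B(v)⁻¹`. -/
def Ymat {n : ℕ} (v : Fin n → ℂ) (k : ℂ) : Mat n :=
  -(k • (aMat n * B v * aMat n * (B v)⁻¹))

/-- `p_{v,k}(λ) = a λ - k a B(v) a B(v)⁻¹`, for nonsingular `B(v)`. -/
def pMat {n : ℕ} (v : Fin n → ℂ) (k z : ℂ) : Mat n := z • aMat n + Ymat v k

/-- `a u a⁻¹ + [Y, a] a⁻¹`. -/
def transform {n : ℕ} (u Y : ℝ × ℝ → Mat n) (p : ℝ × ℝ) : Mat n :=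
  aMat n * u p * (aMat n)⁻¹ + (Y p * aMat n - aMat n * Y p) * (aMat n)⁻¹

/-- `Y` is a smooth solution over `O` of the Bäcklund system
`Y_x = Y u - ũ Y`, `Y_t = Y Q_{a,n+1}(u) - Q_{a,n+1}(ũ) Y`, `τ⁻¹ Y τ = Y`, where
`ũ = a u a⁻¹ + [Y, a] a⁻¹`. -/
structure IsBacklundSolution (n : ℕ) (O : Set (ℝ × ℝ)) (u Y : ℝ × ℝ → Mat n) : Prop where
  smooth : ContDiffOn ℝ ∞ Y O
  eqn_x : ∀ p ∈ O, dx Y p = Y p * u p - transform u Y p * Y p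
  eqn_t : ∀ p ∈ O, dt Y p =
    Y p * Q u (n + 1) p - Q (transform u Y) (n + 1) p * Y p
  reality : ∀ p ∈ O, (tau n)⁻¹ * Y p * tau n = Y p

end KW

end

/-! Put m_w = k B(w) a B(w)⁻¹ (`poleMat`). The column τ^{-j} w of B(w) is an eigenvector of m_w with
eigenvalue α^j k; moreover Ỹ = -a m for m = m_ṽ, and p_{w,k}(λ) = a(λ - m_w).

Hierarchy. The series V = ∑ Q_{a,j}(u) X^j, with X = λ⁻¹, is the only one with leading coefficient
a, V^n = 1 and X V_x + [a + uX, V] = 0 (`hierarchy_aux`, `coeff_eq_Q_of_recursion`). These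
conditions are stable under gauge transformations. If Y_x = Yu - ũY, then a + YX is a gauge
transformation from u to ũ, so it conjugates the series of u to that of ũ (`qSeries_transform_mul`).
Comparing coefficients gives `Q_transform_relation`, from which the t-equations and the KW equation
for ũ follow algebraically. Uniqueness also gives the symmetry `tauConj_Q`.

Evolution of Ỹ. For j ≤ n+1, τ⁻¹ Q_{a,j} τ = α^{n+1-j} Q_{a,j}. Hence the linear equation for ṽ at λ
= k lifts to B(ṽ)' = -H B(ṽ), where H is the Lax coefficient with m substituted for λ on the right,
and so m' = [m, H] (`hasDerivAt_poleMat`). Multiplying by -a turns this into the Bäcklund system.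

The new trivialization. By uniqueness E(αλ) = τ⁻¹ E(λ) τ, so E(α^j k) sends τ^{-j} ṽ to τ^{-j} v,
which α^j k - m_v kills. Thus column j of (λ - m_v) E B(ṽ) vanishes at λ = α^j k, and the pole of
p_ṽ⁻¹ there is removable (`dressNum_root`, `dressE_mul_pMat`). For λ^n ≠ k^n the equations of Ẽ are
a gauge computation; the remaining λ are reached by a limit.

The analysis rests on Grönwall's inequality for total linear equations on the plane: uniqueness,
holomorphic dependence on λ, and stability of solutions under limits. -/

namespace KW

/-! ### Matrix algebra of a, τ and B(w) -/

section Algebra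

variable {n : ℕ}

theorem tau_apply [NeZero n] (i j : Fin n) : tau n i j = if i = j + 1 then 1 else 0 := by
  simp [tau]

theorem tau_mul_transpose [NeZero n] : tau n * (tau n)ᵀ = 1 := by
  ext i j
  rw [Matrix.mul_apply, Finset.sum_eq_single (i - 1)]
  · simp [tau_apply, Matrix.one_apply, eq_comm]
  · intro b _ hb
    have : ¬ i = b + 1 := fun h => hb (by rw [h]; simp)
    simp [tau_apply, this]
  · simp

theorem isUnit_det_tau [NeZero n] : IsUnit (tau n).det :=
  Matrix.isUnit_det_of_right_inverse tau_mul_transpose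

theorem tau_inv [NeZero n] : (tau n)⁻¹ = (tau n)ᵀ :=
  Matrix.inv_eq_right_inv tau_mul_transpose

theorem tau_inv_mul_apply [NeZero n] {m : Type*} (A : Matrix (Fin n) m ℂ) (i : Fin n) (j : m) :
    ((tau n)⁻¹ * A) i j = A (i + 1) j := by
  rw [tau_inv, Matrix.mul_apply, Finset.sum_eq_single (i + 1)]
  · simp [tau_apply]
  · intro b _ hb
    simp [tau_apply, hb]
  · simp

theorem tau_inv_mulVec [NeZero n] (w : Fin n → ℂ) (i : Fin n) :
    ((tau n)⁻¹ *ᵥ w) i = w (i + 1) := by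
  rw [tau_inv, Matrix.mulVec, dotProduct, Finset.sum_eq_single (i + 1)]
  · simp [tau_apply]
  · intro b _ hb
    simp [tau_apply, hb]
  · simp

theorem mul_tau_apply [NeZero n] {m : Type*} (A : Matrix m (Fin n) ℂ) (i : m) (j : Fin n) :
    (A * tau n) i j = A i (j + 1) := by
  rw [Matrix.mul_apply, Finset.sum_eq_single (j + 1)]
  · simp [tau_apply]
  · intro b _ hb
    simp [tau_apply, hb]
  · simp

theorem tau_inv_pow_mulVec [NeZero n] (w : Fin n → ℂ) (l : ℕ) (i : Fin n) :
    (((tau n)⁻¹ ^ l) *ᵥ w) i = w (i + Fin.ofNat n l) := by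
  induction l generalizing i with
  | zero => simp [Fin.ofNat]
  | succ l ih =>
    rw [pow_succ', ← Matrix.mulVec_mulVec, tau_inv_mulVec, ih]
    congr 1
    rw [add_assoc]
    congr 1
    ext
    simp [Fin.val_add, Fin.ofNat, add_comm]

theorem B_apply [NeZero n] (w : Fin n → ℂ) (i j : Fin n) : B w i j = w (i + j) := by
  rw [B, Matrix.of_apply, tau_inv_pow_mulVec, Fin.ofNat_val_eq_self]

/-- Both sides have the entries w (i + j + 1), since B(w) depends only on the sum of its indices. -/
theorem tau_inv_mul_B [NeZero n] (w : Fin n → ℂ) : (tau n)⁻¹ * B w = B w * tau n := by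
  ext i j
  rw [tau_inv_mul_apply, mul_tau_apply, B_apply, B_apply]
  congr 1
  abel

theorem root_isPrimitiveRoot (hn : n ≠ 0) : IsPrimitiveRoot (root n) n :=
  Complex.isPrimitiveRoot_exp n hn

theorem root_pow_self [NeZero n] : root n ^ n = 1 :=
  (root_isPrimitiveRoot (NeZero.ne n)).pow_eq_one

theorem root_ne_zero : root n ≠ 0 := Complex.exp_ne_zero _

theorem root_pow_mod [NeZero n] (m : ℕ) : root n ^ (m % n) = root n ^ m :=
  (pow_eq_pow_mod m root_pow_self).symm

theorem root_pow_injective [NeZero n] {i j : Fin n} (h : root n ^ (i : ℕ) = root n ^ (j : ℕ)) :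
    i = j :=
  Fin.ext ((root_isPrimitiveRoot (NeZero.ne n)).pow_inj i.2 j.2 h)

theorem aMat_apply_ne [NeZero n] {i j : Fin n} (h : i ≠ j) : aMat n i i - aMat n j j ≠ 0 := by
  rw [sub_ne_zero]
  intro h'
  simp only [aMat, Matrix.diagonal_apply_eq] at h'
  exact h (root_pow_injective h')

theorem aMat_apply_self (i : Fin n) : aMat n i i = root n ^ (i : ℕ) := by simp [aMat]

theorem aMat_pow_self [NeZero n] : aMat n ^ n = 1 := by
  rw [aMat, Matrix.diagonal_pow, ← Matrix.diagonal_one]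
  congr 1
  ext i
  simp only [Pi.pow_apply]
  rw [← pow_mul, mul_comm, pow_mul, root_pow_self, one_pow]

theorem isUnit_det_aMat : IsUnit (aMat n).det := by
  rw [aMat, Matrix.det_diagonal, isUnit_iff_ne_zero]
  exact Finset.prod_ne_zero_iff.2 fun i _ => pow_ne_zero _ root_ne_zero

theorem aMat_mul_inv : aMat n * (aMat n)⁻¹ = 1 := Matrix.mul_nonsing_inv _ isUnit_det_aMat

theorem aMat_inv_mul : (aMat n)⁻¹ * aMat n = 1 := Matrix.nonsing_inv_mul _ isUnit_det_aMat

/-- The wrap-around from index n-1 to index 0 is harmless because α^n = 1. -/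
theorem aMat_mul_tau [NeZero n] : aMat n * tau n = root n • (tau n * aMat n) := by
  ext i j
  rw [mul_tau_apply, Matrix.smul_apply]
  simp only [aMat, Matrix.mul_diagonal, tau_apply, Matrix.diagonal_apply]
  split_ifs with h
  · subst h
    rw [smul_eq_mul, one_mul, ← pow_succ', Fin.val_add, Fin.val_one', Nat.add_mod_mod,
      root_pow_mod]
  · simp

theorem tau_conj_aMat [NeZero n] : (tau n)⁻¹ * aMat n * tau n = root n • aMat n := by
  rw [Matrix.mul_assoc, aMat_mul_tau, Matrix.mul_smul, ← Matrix.mul_assoc,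
    Matrix.nonsing_inv_mul _ isUnit_det_tau, Matrix.one_mul]

theorem tau_conj_mul [NeZero n] (A C : Mat n) :
    (tau n)⁻¹ * (A * C) * tau n = ((tau n)⁻¹ * A * tau n) * ((tau n)⁻¹ * C * tau n) := by
  have h := Matrix.mul_nonsing_inv _ (isUnit_det_tau (n := n))
  calc (tau n)⁻¹ * (A * C) * tau n = (tau n)⁻¹ * A * 1 * C * tau n := by
        simp only [Matrix.mul_assoc, Matrix.one_mul]
    _ = _ := by rw [← h]; simp only [Matrix.mul_assoc]

/-- Conjugation `y ↦ τ⁻¹ y τ` as a ring homomorphism. -/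
noncomputable def tauConj (n : ℕ) [NeZero n] : Mat n →+* Mat n where
  toFun y := (tau n)⁻¹ * y * tau n
  map_one' := by rw [Matrix.mul_one, Matrix.nonsing_inv_mul _ isUnit_det_tau]
  map_mul' := tau_conj_mul
  map_zero' := by simp
  map_add' A C := by rw [Matrix.mul_add, Matrix.add_mul]

theorem tauConj_apply [NeZero n] (y : Mat n) : tauConj n y = (tau n)⁻¹ * y * tau n := rfl

theorem tauConj_smul [NeZero n] (c : ℂ) (y : Mat n) : tauConj n (c • y) = c • tauConj n y := by
  simp [tauConj_apply]

theorem tauConj_aMat [NeZero n] : tauConj n (aMat n) = root n • aMat n := tau_conj_aMat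

theorem tauConj_aMat_inv [NeZero n] : tauConj n (aMat n)⁻¹ = (root n)⁻¹ • (aMat n)⁻¹ := by
  have h : tauConj n (aMat n)⁻¹ * (root n • aMat n) = 1 := by
    rw [← tauConj_aMat, ← map_mul, aMat_inv_mul, map_one]
  calc tauConj n (aMat n)⁻¹ = tauConj n (aMat n)⁻¹ * (root n • aMat n) *
        ((root n)⁻¹ • (aMat n)⁻¹) := by
        rw [Matrix.mul_assoc, Matrix.smul_mul, Matrix.mul_smul (aMat n), smul_smul, aMat_mul_inv,
          mul_inv_cancel₀ root_ne_zero, one_smul, Matrix.mul_one]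
    _ = _ := by rw [h, Matrix.one_mul]

/-- If `τ⁻¹ q τ = α ^ e q`, then `B (q w) = q B(w) a ^ e`. -/
theorem B_mulVec [NeZero n] {q : Mat n} {e : ℕ} (hq : tauConj n q = root n ^ e • q)
    (w : Fin n → ℂ) : B (q *ᵥ w) = q * B w * aMat n ^ e := by
  have hcomm : (tau n)⁻¹ * q = root n ^ e • (q * (tau n)⁻¹) := by
    rw [← Matrix.smul_mul, ← hq, tauConj_apply, Matrix.mul_assoc,
      Matrix.mul_nonsing_inv _ isUnit_det_tau, Matrix.mul_one]
  -- Moving q through τ^{-l} costs α^{el}; for column l this is exactly the diagonal entry of a^e.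
  have hpow : ∀ l : ℕ, (tau n)⁻¹ ^ l * q = root n ^ (e * l) • (q * (tau n)⁻¹ ^ l) := by
    intro l
    induction l with
    | zero => simp
    | succ l ih =>
      rw [pow_succ, Matrix.mul_assoc, hcomm, Matrix.mul_smul, ← Matrix.mul_assoc, ih,
        Matrix.smul_mul, smul_smul, Matrix.mul_assoc, mul_add, pow_add, mul_one, mul_comm]
  ext i j
  rw [aMat, Matrix.diagonal_pow, Matrix.mul_diagonal]
  have h1 : B (q *ᵥ w) i j = (root n ^ (e * (j : ℕ)) • (q *ᵥ ((tau n)⁻¹ ^ (j : ℕ) *ᵥ w))) i := by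
    simp only [B, Matrix.of_apply, Matrix.mulVec_mulVec]
    rw [hpow, Matrix.smul_mulVec]
  rw [h1, Pi.smul_apply, smul_eq_mul, Pi.pow_apply, ← pow_mul, mul_comm, mul_comm (j : ℕ) e]
  rfl

/-- An eigenvector of `y ↦ τ⁻¹ y τ` in column form. -/
theorem mul_B_col [NeZero n] {F G : Mat n} {j : Fin n}
    (h : F * (tau n)⁻¹ ^ (j : ℕ) = (tau n)⁻¹ ^ (j : ℕ) * G) (w : Fin n → ℂ) (i : Fin n) :
    (F * B w) i j = B (G *ᵥ w) i j := by
  have h1 : (F * B w) i j = (F *ᵥ ((tau n)⁻¹ ^ (j : ℕ) *ᵥ w)) i := rfl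
  rw [h1, Matrix.mulVec_mulVec, h, ← Matrix.mulVec_mulVec]
  rfl

/-- Testing against diag(e_r - e_s), which is traceless and commutes with a, makes all diagonal
entries equal; their sum is the trace, which is zero. -/
theorem slPerp_diag [NeZero n] {y : Mat n} (hy : y ∈ slPerp n) (i : Fin n) : y i i = 0 := by
  have heq : ∀ r s : Fin n, y r r = y s s := by
    intro r s
    have hb : (Matrix.diagonal (Pi.single r 1 - Pi.single s 1) : Mat n) ∈ slCent n := by
      refine ⟨?_, ?_⟩
      · simp [Matrix.trace_diagonal]
      · rw [aMat, Matrix.diagonal_mul_diagonal, Matrix.diagonal_mul_diagonal, sub_eq_zero]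
        congr 1; ext i; ring
    have h := hy.2 _ hb
    rw [Matrix.trace] at h
    simp only [Matrix.diag_apply, Matrix.diagonal_mul, Pi.sub_apply, sub_mul,
      Finset.sum_sub_distrib, Pi.single_apply, ite_mul, one_mul, zero_mul, Finset.sum_ite_eq',
      Finset.mem_univ, if_true] at h
    exact sub_eq_zero.1 h
  have ht := hy.1
  have hd : y.diag = fun _ => y i i := funext fun r => heq r i
  rw [Matrix.trace, hd] at ht
  simpa [NeZero.ne n] using ht

/-- The diagonal entries of a are distinct, so its centralizer is diagonal and does not see the
off-diagonal part of y. -/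
theorem mem_slPerp_of_diag [NeZero n] {y : Mat n} (hy : ∀ i, y i i = 0) : y ∈ slPerp n := by
  refine ⟨by simp [Matrix.trace, hy], fun b hb => ?_⟩
  have hoff : ∀ r s, r ≠ s → b r s = 0 := by
    intro r s hrs
    have h := congrFun (congrFun hb.2 r) s
    have ha : aMat n r r - aMat n s s ≠ 0 := aMat_apply_ne hrs
    rw [aMat_apply_self, aMat_apply_self] at ha
    simp only [aMat, Matrix.sub_apply, Matrix.diagonal_mul, Matrix.mul_diagonal,
      Matrix.zero_apply] at h
    rw [mul_comm, ← mul_sub] at h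
    exact (mul_eq_zero.1 h).resolve_right ha
  rw [Matrix.trace]
  refine Finset.sum_eq_zero fun i _ => ?_
  rw [Matrix.diag_apply, Matrix.mul_apply]
  refine Finset.sum_eq_zero fun j _ => ?_
  by_cases h : i = j
  · rw [h, hy, mul_zero]
  · rw [hoff i j h, zero_mul]

end Algebra

/-! ### Noncommutative power series and the linearized power map -/

section Series

variable {R : Type*} [Ring R]

/-- The sum `∑_{i<N} V^i W V^(N-1-i)`, in recursive form. -/
def leibnizSum {S : Type*} [Ring S] (V W : S) : ℕ → S
  | 0 => 0
  | N + 1 => leibnizSum V W N * V + V ^ N * W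

/-- The Leibniz rule for the derivation [A, ·] applied to V ^ N. -/
theorem leibnizSum_commutator {S : Type*} [Ring S] (A V : S) (N : ℕ) :
    leibnizSum V (A * V - V * A) N = A * V ^ N - V ^ N * A := by
  induction N with
  | zero => simp [leibnizSum]
  | succ N ih => rw [leibnizSum, ih, pow_succ]; noncomm_ring

theorem leibnizSum_add {S : Type*} [Ring S] (V W W' : S) (N : ℕ) :
    leibnizSum V (W + W') N = leibnizSum V W N + leibnizSum V W' N := by
  induction N with
  | zero => simp [leibnizSum]
  | succ N ih => rw [leibnizSum, leibnizSum, leibnizSum, ih]; noncomm_ring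

theorem leibnizSum_mul_left {S : Type*} [Ring S] (V W c : S) (hc : Commute c V) (N : ℕ) :
    leibnizSum V (c * W) N = c * leibnizSum V W N := by
  induction N with
  | zero => simp [leibnizSum]
  | succ N ih =>
    rw [leibnizSum, leibnizSum, ih, mul_add, mul_assoc, ← mul_assoc c (V ^ N),
      (hc.pow_right N).eq, mul_assoc]

theorem leibnizSum_of_commute {S : Type*} [Ring S] (V W : S) (h : Commute V W) (N : ℕ) :
    leibnizSum V W N = N • (V ^ (N - 1) * W) := by
  induction N with
  | zero => simp [leibnizSum]
  | succ N ih =>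
    rw [leibnizSum, ih, smul_mul_assoc, mul_assoc, ← h.eq, ← mul_assoc, ← pow_succ,
      add_smul, one_smul]
    rcases N with _ | N
    · simp
    · simp

open PowerSeries

/-- The lowest coefficient of `F * G` when `F = O(X^m)`. -/
theorem coeff_mul_of_low_left {F G : R⟦X⟧} {m : ℕ} (hF : ∀ i < m, coeff i F = 0) :
    coeff m (F * G) = coeff m F * coeff 0 G := by
  rw [coeff_mul, Finset.sum_eq_single (m, 0)]
  · rintro ⟨i, j⟩ hij hne
    rw [Finset.HasAntidiagonal.mem_antidiagonal] at hij
    have : i < m := by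
      rcases Nat.lt_or_ge i m with h | h
      · exact h
      · exact absurd (by ext <;> simp <;> omega) hne
    rw [hF i this, zero_mul]
  · simp

theorem coeff_mul_of_low_right {F G : R⟦X⟧} {m : ℕ} (hG : ∀ i < m, coeff i G = 0) :
    coeff m (F * G) = coeff 0 F * coeff m G := by
  rw [coeff_mul, Finset.sum_eq_single (0, m)]
  · rintro ⟨i, j⟩ hij hne
    rw [Finset.HasAntidiagonal.mem_antidiagonal] at hij
    have : j < m := by
      rcases Nat.lt_or_ge j m with h | h
      · exact h
      · exact absurd (by ext <;> simp <;> omega) hne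
    rw [hG j this, mul_zero]
  · simp

theorem coeff_zero_pow (F : R⟦X⟧) (N : ℕ) : coeff 0 (F ^ N) = coeff 0 F ^ N := by
  simp

/-- The linearized power map is linear in W, so at the lowest order of W only the constant term of V
contributes. -/
theorem coeff_leibnizSum_of_low {V W : R⟦X⟧} {m : ℕ} (hW : ∀ i < m, coeff i W = 0) (N : ℕ) :
    (∀ i < m, coeff i (leibnizSum V W N) = 0) ∧
      coeff m (leibnizSum V W N) = leibnizSum (coeff 0 V) (coeff m W) N := by
  induction N with
  | zero => simp [leibnizSum]
  | succ N ih =>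
    refine ⟨fun i hi => ?_, ?_⟩
    · rw [leibnizSum, map_add, coeff_mul_of_low_left (fun l hl => ih.1 l (hl.trans hi)),
        coeff_mul_of_low_right (fun l hl => hW l (hl.trans hi)), ih.1 i hi, hW i hi]
      simp
    · rw [leibnizSum, map_add, coeff_mul_of_low_left ih.1, coeff_mul_of_low_right hW, ih.2,
        coeff_zero_pow, leibnizSum]

/-- If `F` and `G` agree up to order `m - 1`, then the `m`-th coefficients of `F ^ N` and `G ^ N`
differ by the linearization of the power map. -/
theorem coeff_pow_sub_of_agree {F G : R⟦X⟧} {m : ℕ} (hm : m ≠ 0)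
    (h : ∀ i < m, coeff i F = coeff i G) (N : ℕ) :
    (∀ i < m, coeff i (F ^ N) = coeff i (G ^ N)) ∧
      coeff m (F ^ N) = coeff m (G ^ N) +
        leibnizSum (coeff 0 G) (coeff m F - coeff m G) N := by
  have h0 := h 0 (Nat.pos_of_ne_zero hm)
  induction N with
  | zero => simp [leibnizSum]
  | succ N ih =>
    have key : F ^ (N + 1) - G ^ (N + 1) = (F ^ N - G ^ N) * F + G ^ N * (F - G) := by
      rw [pow_succ, pow_succ]; noncomm_ring
    have l1 : ∀ i < m, coeff i (F ^ N - G ^ N) = 0 := fun i hi => by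
      rw [map_sub, ih.1 i hi, sub_self]
    have l2 : ∀ i < m, coeff i (F - G) = 0 := fun i hi => by rw [map_sub, h i hi, sub_self]
    refine ⟨fun i hi => ?_, ?_⟩
    · rw [← sub_eq_zero, ← map_sub, key, map_add,
        coeff_mul_of_low_left (fun l hl => l1 l (hl.trans hi)),
        coeff_mul_of_low_right (fun l hl => l2 l (hl.trans hi)), l1 i hi, l2 i hi]
      simp
    · rw [← sub_eq_iff_eq_add', ← map_sub, key, map_add, coeff_mul_of_low_left l1,
        coeff_mul_of_low_right l2, map_sub, map_sub, ih.2, coeff_zero_pow, leibnizSum, h0]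
      simp

/-- Powers of series with coefficients rescaled and twisted by a ring homomorphism. -/
theorem coeff_pow_semilinear {K : Type*} [CommRing K] [Algebra K R] (φ : R →+* R)
    (γ β : K) {F G : R⟦X⟧}
    (h : ∀ m, coeff m F = (γ * β ^ m) • φ (coeff m G)) (N m : ℕ) :
    coeff m (F ^ N) = (γ ^ N * β ^ m) • φ (coeff m (G ^ N)) := by
  induction N generalizing m with
  | zero =>
    rw [pow_zero, pow_zero, pow_zero, coeff_one]
    split_ifs with hm
    · simp [hm]
    · simp
  | succ N ih =>
    rw [pow_succ F, pow_succ G, pow_succ γ, coeff_mul, coeff_mul, map_sum, Finset.smul_sum]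
    refine Finset.sum_congr rfl fun ij hij => ?_
    rw [ih, h, map_mul, smul_mul_smul_comm, ← Finset.HasAntidiagonal.mem_antidiagonal.1 hij]
    congr 1
    ring

end Series

/-! ### Smoothness and partial derivatives of matrix functions and series -/

section Smoothness

attribute [local instance] Matrix.linftyOpNormedRing Matrix.linftyOpNormedAlgebra

open PowerSeries

variable {R : Type*} [NormedRing R] [NormedAlgebra ℝ R]

/-- Coefficientwise differentiability of a curve of power series. -/
def HasCoeffDerivAt (F : ℝ → R⟦X⟧) (F' : R⟦X⟧) (s : ℝ) : Prop :=
  ∀ m, HasDerivAt (fun t => coeff m (F t)) (coeff m F') s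

theorem HasCoeffDerivAt.mul {F G : ℝ → R⟦X⟧} {F' G' : R⟦X⟧} {s : ℝ}
    (hF : HasCoeffDerivAt F F' s) (hG : HasCoeffDerivAt G G' s) :
    HasCoeffDerivAt (fun t => F t * G t) (F' * G s + F s * G') s := by
  intro m
  simp only [coeff_mul, map_add, ← Finset.sum_add_distrib]
  exact HasDerivAt.fun_sum fun ij _ => (hF ij.1).mul (hG ij.2)

theorem HasCoeffDerivAt.pow {F : ℝ → R⟦X⟧} {F' : R⟦X⟧} {s : ℝ}
    (hF : HasCoeffDerivAt F F' s) (N : ℕ) :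
    HasCoeffDerivAt (fun t => F t ^ N) (leibnizSum (F s) F' N) s := by
  induction N with
  | zero =>
    intro m
    simp only [pow_zero, leibnizSum, map_zero]
    exact hasDerivAt_const _ _
  | succ N ih =>
    simp only [pow_succ]
    exact ih.mul hF

theorem contDiffOn_coeff_mul {P : Type*} [NormedAddCommGroup P] [NormedSpace ℝ P] {s : Set P}
    {F G : P → R⟦X⟧} (hF : ∀ m, ContDiffOn ℝ ∞ (fun p => coeff m (F p)) s)
    (hG : ∀ m, ContDiffOn ℝ ∞ (fun p => coeff m (G p)) s) (m : ℕ) :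
    ContDiffOn ℝ ∞ (fun p => coeff m (F p * G p)) s := by
  simp only [coeff_mul]
  exact ContDiffOn.sum fun ij _ => (hF ij.1).mul (hG ij.2)

theorem contDiffOn_coeff_pow {P : Type*} [NormedAddCommGroup P] [NormedSpace ℝ P] {s : Set P}
    {F : P → R⟦X⟧} (hF : ∀ m, ContDiffOn ℝ ∞ (fun p => coeff m (F p)) s) (N m : ℕ) :
    ContDiffOn ℝ ∞ (fun p => coeff m (F p ^ N)) s := by
  induction N generalizing m with
  | zero => simp only [pow_zero]; exact contDiffOn_const
  | succ N ih => simp only [pow_succ]; exact contDiffOn_coeff_mul ih hF m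

variable {n : ℕ}

/-- The entry functional, as a continuous real-linear map. -/
noncomputable def entryCLM (n : ℕ) (i j : Fin n) : Mat n →L[ℝ] ℂ :=
  LinearMap.toContinuousLinearMap
    { toFun := fun y => y i j
      map_add' := fun _ _ => rfl
      map_smul' := fun _ _ => rfl }

theorem contDiffOn_mat_iff {P : Type*} [NormedAddCommGroup P] [NormedSpace ℝ P] {s : Set P}
    {f : P → Mat n} {r : ℕ∞ω} :
    ContDiffOn ℝ r f s ↔ ∀ i j, ContDiffOn ℝ r (fun p => f p i j) s := by
  refine ⟨fun h i j => (entryCLM n i j).contDiff.comp_contDiffOn h, fun h => ?_⟩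
  have hf : f = fun p => ∑ i, ∑ j, f p i j • Matrix.single i j (1 : ℂ) := by
    ext1 p
    conv_lhs => rw [Matrix.matrix_eq_sum_single (f p)]
    simp
  rw [hf]
  exact ContDiffOn.sum fun i _ => ContDiffOn.sum fun j _ => (h i j).smul contDiffOn_const

theorem hasDerivAt_mat_iff {f : ℝ → Mat n} {f' : Mat n} {s : ℝ} :
    HasDerivAt f f' s ↔ ∀ i j, HasDerivAt (fun t => f t i j) (f' i j) s := by
  refine ⟨fun h i j => (entryCLM n i j).hasFDerivAt.comp_hasDerivAt s h, fun h => ?_⟩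
  have hf : ∀ g : Mat n, g = ∑ i, ∑ j, g i j • Matrix.single i j (1 : ℂ) := by
    intro g
    conv_lhs => rw [Matrix.matrix_eq_sum_single g]
    simp
  rw [hf f', funext fun t => hf (f t)]
  exact HasDerivAt.fun_sum fun i _ => HasDerivAt.fun_sum fun j _ => (h i j).smul_const _

theorem hasDerivAt_slice_fst {E : Type*} [NormedAddCommGroup E] [NormedSpace ℝ E]
    {f : ℝ × ℝ → E} {p : ℝ × ℝ} {f' : ℝ × ℝ →L[ℝ] E} (h : HasFDerivAt f f' p) :
    HasDerivAt (fun s => f (s, p.2)) (f' (1, 0)) p.1 :=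
  HasFDerivAt.comp_hasDerivAt (f := fun s : ℝ => (s, p.2)) p.1 h
    ((hasDerivAt_id p.1).prodMk (hasDerivAt_const p.1 p.2))

theorem hasDerivAt_slice_snd {E : Type*} [NormedAddCommGroup E] [NormedSpace ℝ E]
    {f : ℝ × ℝ → E} {p : ℝ × ℝ} {f' : ℝ × ℝ →L[ℝ] E} (h : HasFDerivAt f f' p) :
    HasDerivAt (fun s => f (p.1, s)) (f' (0, 1)) p.2 :=
  HasFDerivAt.comp_hasDerivAt (f := fun s : ℝ => (p.1, s)) p.2 h
    ((hasDerivAt_const p.2 p.1).prodMk (hasDerivAt_id p.2))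

variable {O : Set (ℝ × ℝ)} {f : ℝ × ℝ → Mat n} {p : ℝ × ℝ}

theorem hasFDerivAt_of_contDiffOn (hO : IsOpen O) (hf : ContDiffOn ℝ ∞ f O) (hp : p ∈ O) :
    HasFDerivAt f (fderiv ℝ f p) p :=
  ((hf.contDiffAt (hO.mem_nhds hp)).differentiableAt (by simp)).hasFDerivAt

theorem dx_eq_fderiv (hO : IsOpen O) (hf : ContDiffOn ℝ ∞ f O) (hp : p ∈ O) :
    dx f p = fderiv ℝ f p (1, 0) :=
  (hasDerivAt_slice_fst (hasFDerivAt_of_contDiffOn hO hf hp)).deriv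

theorem dt_eq_fderiv (hO : IsOpen O) (hf : ContDiffOn ℝ ∞ f O) (hp : p ∈ O) :
    dt f p = fderiv ℝ f p (0, 1) :=
  (hasDerivAt_slice_snd (hasFDerivAt_of_contDiffOn hO hf hp)).deriv

theorem hasDerivAt_dx (hO : IsOpen O) (hf : ContDiffOn ℝ ∞ f O) (hp : p ∈ O) :
    HasDerivAt (fun s => f (s, p.2)) (dx f p) p.1 := by
  rw [dx_eq_fderiv hO hf hp]
  exact hasDerivAt_slice_fst (hasFDerivAt_of_contDiffOn hO hf hp)

theorem hasDerivAt_dt (hO : IsOpen O) (hf : ContDiffOn ℝ ∞ f O) (hp : p ∈ O) :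
    HasDerivAt (fun s => f (p.1, s)) (dt f p) p.2 := by
  rw [dt_eq_fderiv hO hf hp]
  exact hasDerivAt_slice_snd (hasFDerivAt_of_contDiffOn hO hf hp)

theorem contDiffOn_fderiv_apply {E F : Type*} [NormedAddCommGroup E] [NormedSpace ℝ E]
    [NormedAddCommGroup F] [NormedSpace ℝ F] {s : Set E} {g : E → F} (hs : IsOpen s)
    (hg : ContDiffOn ℝ ∞ g s) (v : E) : ContDiffOn ℝ ∞ (fun p => fderiv ℝ g p v) s := by
  have h : ContDiffOn ℝ ∞ (fderiv ℝ g) s := hg.fderiv_of_isOpen hs (by simp)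
  exact h.clm_apply contDiffOn_const

theorem contDiffOn_dx (hO : IsOpen O) (hf : ContDiffOn ℝ ∞ f O) : ContDiffOn ℝ ∞ (dx f) O := by
  exact (contDiffOn_fderiv_apply hO hf (1, 0)).congr fun p hp => dx_eq_fderiv hO hf hp

theorem eventually_slice_fst (hO : IsOpen O) (hp : p ∈ O) :
    ∀ᶠ s in nhds p.1, (s, p.2) ∈ O :=
  (Continuous.prodMk_left p.2).continuousAt.eventually (hO.mem_nhds hp)

theorem dx_congr {g : ℝ × ℝ → Mat n} (hO : IsOpen O) (h : ∀ q ∈ O, f q = g q) (hp : p ∈ O) :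
    dx f p = dx g p :=
  Filter.EventuallyEq.deriv_eq ((eventually_slice_fst hO hp).mono fun _ hs => h _ hs)

end Smoothness

/-! ### The hierarchy Q_{a,j}: full recursion and uniqueness -/

section Hierarchy

attribute [local instance] Matrix.linftyOpNormedRing Matrix.linftyOpNormedAlgebra

open PowerSeries

variable {n : ℕ}

/-- On diagonal entries the diagonal matrix a behaves as a scalar. For N = n the factor n a^{n-1} is
invertible, which is what determines the diagonal parts. -/
theorem leibnizSum_aMat_diag [NeZero n] (y : Mat n) (N : ℕ) (r : Fin n) :
    leibnizSum (aMat n) y N r r = N * (aMat n r r) ^ (N - 1) * y r r := by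
  have hpow : ∀ l, aMat n ^ l = diagonal fun i : Fin n => (root n ^ (i : ℕ)) ^ l := fun l => by
    rw [aMat, diagonal_pow]; rfl
  induction N with
  | zero => simp [leibnizSum]
  | succ N ih =>
    rw [leibnizSum, Matrix.add_apply, hpow, Matrix.diagonal_mul]
    conv_lhs => rw [aMat, Matrix.mul_diagonal, ← aMat, ih, aMat_apply_self]
    rw [aMat_apply_self]
    rcases N with _ | N
    · simp
    · push_cast
      simp only [pow_succ]
      ring

theorem aMat_diag_pow [NeZero n] (r : Fin n) : (aMat n r r) ^ (n - 1) * aMat n r r = 1 := by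
  rw [← pow_succ, Nat.sub_add_cancel (Nat.pos_of_ne_zero (NeZero.ne n)), aMat_apply_self,
    ← pow_mul, mul_comm, pow_mul, root_pow_self, one_pow]

theorem commutator_aMat_apply (y : Mat n) (r s : Fin n) :
    (y * aMat n - aMat n * y) r s = y r s * (aMat n s s - aMat n r r) := by
  rw [aMat_apply_self, aMat_apply_self, aMat, Matrix.sub_apply, Matrix.mul_diagonal,
    Matrix.diagonal_mul]
  ring

/-- The generating series `∑ Q_{a,j}(u) X^j`, with `X = λ⁻¹`. -/
noncomputable def qSeries (u : ℝ × ℝ → Mat n) (p : ℝ × ℝ) : (Mat n)⟦X⟧ :=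
  PowerSeries.mk fun j => Q u j p

theorem coeff_qSeries (u : ℝ × ℝ → Mat n) (p : ℝ × ℝ) (j : ℕ) :
    coeff j (qSeries u p) = Q u j p := coeff_mk _ _

/-- The series `∑_{i<m} c_i X^i`, as the image of a sum of monomials. -/
theorem coeff_coe_sum_monomial (c : ℕ → Mat n) (m i : ℕ) :
    coeff i ((∑ l : Fin m, Polynomial.monomial (l : ℕ) (c l) : Polynomial (Mat n)) :
      (Mat n)⟦X⟧) = if i < m then c i else 0 := by
  rw [Polynomial.coeff_coe, Polynomial.finsetSum_coeff,
    Fin.sum_univ_eq_sum_range (fun l => (Polynomial.monomial l (c l)).coeff i)]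
  simp only [Polynomial.coeff_monomial, Finset.sum_ite_eq', Finset.mem_range]

theorem Q_zero (u : ℝ × ℝ → Mat n) (p : ℝ × ℝ) : Q u 0 p = aMat n := by rw [Q]

/-- The contribution of `Q_{a,0}, …, Q_{a,j}` to the coefficient of order `j + 1` of the `n`-th
power of the generating series. -/
noncomputable def powTail (u : ℝ × ℝ → Mat n) (j : ℕ) (p : ℝ × ℝ) : Mat n :=
  coeff (j + 1) ((((∑ l : Fin (j + 1), Polynomial.monomial (l : ℕ) (Q u l p) :
    Polynomial (Mat n)) : (Mat n)⟦X⟧)) ^ n)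

theorem Q_succ_apply (u : ℝ × ℝ → Mat n) (j : ℕ) (p : ℝ × ℝ) (r s : Fin n) :
    Q u (j + 1) p r s = if r = s then -(aMat n r r * powTail u j p r r) / (n : ℂ)
      else (dx (Q u j) p + (u p * Q u j p - Q u j p * u p)) r s / (aMat n s s - aMat n r r) := by
  rw [Q, powTail, ← Polynomial.coe_pow, Polynomial.coeff_coe]
  rfl

theorem Q_succ_commutator_off [NeZero n] (u : ℝ × ℝ → Mat n) (j : ℕ) (p : ℝ × ℝ)
    {r s : Fin n} (h : r ≠ s) :
    (Q u (j + 1) p * aMat n - aMat n * Q u (j + 1) p) r s =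
      (dx (Q u j) p + (u p * Q u j p - Q u j p * u p)) r s := by
  rw [commutator_aMat_apply, Q_succ_apply, if_neg h, div_mul_cancel₀]
  exact aMat_apply_ne (Ne.symm h)

/-- The coefficient of order `j + 1` of the `n`-th power of a series whose lower coefficients are
`Q_{a,0}, …, Q_{a,j}`. -/
theorem coeff_pow_eq_powTail (u : ℝ × ℝ → Mat n) (j : ℕ) (p : ℝ × ℝ) {F : (Mat n)⟦X⟧}
    (hF : ∀ i ≤ j, coeff i F = Q u i p) :
    coeff (j + 1) (F ^ n) = powTail u j p + leibnizSum (aMat n) (coeff (j + 1) F) n := by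
  have h := (coeff_pow_sub_of_agree (F := F) (G := ((∑ l : Fin (j + 1),
    Polynomial.monomial (l : ℕ) (Q u l p) : Polynomial (Mat n)) : (Mat n)⟦X⟧)) (m := j + 1)
    (Nat.succ_ne_zero j) (fun i hi => by
      rw [coeff_coe_sum_monomial (fun l => Q u l p), if_pos hi, hF i (Nat.lt_succ_iff.1 hi)]) n).2
  rw [h, powTail, coeff_coe_sum_monomial (fun l => Q u l p),
    coeff_coe_sum_monomial (fun l => Q u l p), if_pos (Nat.succ_pos j), if_neg (lt_irrefl _),
    sub_zero, Q_zero]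

/-- The diagonal of Q_{a,j+1} was chosen to cancel `powTail`. The diagonal of this coefficient of F
^ n therefore measures the deviation of F from the hierarchy, which serves both existence and
uniqueness. -/
theorem coeff_pow_diag [NeZero n] (u : ℝ × ℝ → Mat n) (j : ℕ) (p : ℝ × ℝ) {F : (Mat n)⟦X⟧}
    (hF : ∀ i ≤ j, coeff i F = Q u i p) (r : Fin n) :
    coeff (j + 1) (F ^ n) r r =
      n * aMat n r r ^ (n - 1) * (coeff (j + 1) F r r - Q u (j + 1) p r r) := by
  have hn : (n : ℂ) ≠ 0 := Nat.cast_ne_zero.2 (NeZero.ne n)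
  rw [coeff_pow_eq_powTail u j p hF, Matrix.add_apply, leibnizSum_aMat_diag, Q_succ_apply,
    if_pos rfl]
  have h := aMat_diag_pow r
  field_simp
  linear_combination (-(powTail u j p r r)) * h

/-- The diagonal part involves all lower coefficients, hence the strong induction. -/
theorem contDiffOn_Q {O : Set (ℝ × ℝ)} (hO : IsOpen O) {u : ℝ × ℝ → Mat n}
    (hu : ContDiffOn ℝ ∞ u O) (j : ℕ) : ContDiffOn ℝ ∞ (Q u j) O := by
  induction j using Nat.strong_induction_on with
  | _ j ih =>
    rcases j with _ | j
    · exact contDiffOn_const.congr fun p _ => Q_zero u p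
    · rw [contDiffOn_mat_iff]
      intro r s
      simp only [Q_succ_apply]
      split_ifs
      · have h : ContDiffOn ℝ ∞ (powTail u j) O := by
          refine contDiffOn_coeff_pow (fun m => ?_) n (j + 1)
          refine ContDiffOn.congr ?_
            (fun p _ => coeff_coe_sum_monomial (fun l => Q u l p) (j + 1) m)
          split_ifs with hm
          · exact ih m hm
          · exact contDiffOn_const
        exact ((contDiffOn_const.mul (contDiffOn_mat_iff.1 h r r)).neg).div_const _
      · have hj := ih j (Nat.lt_succ_self j)
        exact (contDiffOn_mat_iff.1 ((contDiffOn_dx hO hj).add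
          ((hu.mul hj).sub (hj.mul hu))) r s).div_const _

theorem coeff_succ_commutator {R : Type*} [Ring R] (b w : R) (F : R⟦X⟧) (i : ℕ) :
    coeff (i + 1) ((C b + X * C w) * F - F * (C b + X * C w)) =
      (b * coeff (i + 1) F - coeff (i + 1) F * b) + (w * coeff i F - coeff i F * w) := by
  have : (C b + X * C w) * F - F * (C b + X * C w) = C b * F - F * C b +
      X * (C w * F - F * C w) := by
    rw [add_mul, mul_add, mul_sub, ← mul_assoc F X, ← X_mul (φ := F), mul_assoc, mul_assoc]
    abel
  rw [this, map_add, coeff_succ_X_mul, map_sub, map_sub, coeff_C_mul, coeff_mul_C,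
    coeff_C_mul, coeff_mul_C]

/-- The generating series of the hierarchy satisfies `V ^ n = 1` and the recursion holds in full,
including the diagonal entries. -/
theorem hierarchy_aux [NeZero n] {O : Set (ℝ × ℝ)} (hO : IsOpen O) {u : ℝ × ℝ → Mat n}
    (hu : ContDiffOn ℝ ∞ u O) (j : ℕ) : ∀ p ∈ O,
    (∀ i ≤ j, coeff i (qSeries u p ^ n) = coeff i 1) ∧
      ∀ i < j, dx (Q u i) p + (u p * Q u i p - Q u i p * u p) =
        Q u (i + 1) p * aMat n - aMat n * Q u (i + 1) p := by
  have hn : (n : ℂ) ≠ 0 := Nat.cast_ne_zero.2 (NeZero.ne n)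
  induction j with
  | zero =>
    intro p _
    refine ⟨fun i hi => ?_, fun i hi => absurd hi (Nat.not_lt_zero i)⟩
    rw [Nat.le_zero.1 hi, coeff_zero_pow, coeff_qSeries, Q_zero, aMat_pow_self]
    simp
  | succ j ih =>
    intro p hp
    obtain ⟨ih1, ih2⟩ := ih p hp
    set V := qSeries u p with hV
    set V' : (Mat n)⟦X⟧ := PowerSeries.mk fun i => dx (Q u i) p with hV'
    set A : (Mat n)⟦X⟧ := C (aMat n) + X * C (u p) with hA
    -- W is the defect of the recursion. By definition of Q its off-diagonal entries vanish; the
    -- point is to kill the diagonal at order j + 1.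
    set W : (Mat n)⟦X⟧ := X * V' + (A * V - V * A) with hW
    have hcomm : ∀ (F : (Mat n)⟦X⟧) (i : ℕ), coeff (i + 1) (A * F - F * A) =
        (aMat n * coeff (i + 1) F - coeff (i + 1) F * aMat n) +
          (u p * coeff i F - coeff i F * u p) := by
      intro F i
      rw [hA, coeff_succ_commutator]
    have hW0 : coeff 0 W = 0 := by
      have hA0 : coeff 0 A = aMat n := by simp [hA]
      have hlt : ∀ (F : (Mat n)⟦X⟧), ∀ i < 0, coeff i F = 0 := fun _ i hi => absurd hi (by simp)
      rw [hW, map_add, coeff_zero_X_mul, map_sub, coeff_mul_of_low_left (hlt A),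
        coeff_mul_of_low_left (hlt V), hA0, hV, coeff_qSeries, Q_zero]
      simp
    have hWs : ∀ i, coeff (i + 1) W = dx (Q u i) p + (u p * Q u i p - Q u i p * u p) -
        (Q u (i + 1) p * aMat n - aMat n * Q u (i + 1) p) := by
      intro i
      rw [hW, map_add, coeff_succ_X_mul, hcomm, hV', coeff_mk, hV, coeff_qSeries, coeff_qSeries]
      abel
    have hlow : ∀ i < j + 1, coeff i W = 0 := by
      intro i hi
      rcases i with _ | i
      · exact hW0
      · rw [hWs, ih2 i (by omega), sub_self]
    have hderiv : HasCoeffDerivAt (fun s => qSeries u (s, p.2)) V' p.1 := by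
      intro m
      simp only [coeff_qSeries, hV', coeff_mk]
      exact hasDerivAt_dx hO (contDiffOn_Q hO hu m) hp
    -- Differentiate the order j coefficient of V^n = 1 in x. This uses the induction hypothesis at
    -- nearby points, not only at p.
    have hzero : coeff j (leibnizSum V V' n) = 0 := by
      have h1 := hderiv.pow n j
      have h2 : HasDerivAt (fun s => coeff j (qSeries u (s, p.2) ^ n)) (0 : Mat n) p.1 :=
        (hasDerivAt_const p.1 (coeff j (1 : (Mat n)⟦X⟧))).congr_of_eventuallyEq
          ((eventually_slice_fst hO hp).mono fun s hs => (ih _ hs).1 j le_rfl)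
      exact h1.unique h2
    -- Linearize the power map in the direction W = X V' + [A, V]: the first term drops by `hzero`,
    -- the second gives [A, V^n]. The commutator with a on the right has zero diagonal, while the
    -- left side has diagonal n a^{n-1} diag W.
    have hkey : leibnizSum (aMat n) (coeff (j + 1) W) n =
        aMat n * coeff (j + 1) (V ^ n) - coeff (j + 1) (V ^ n) * aMat n := by
      have h1 := (coeff_leibnizSum_of_low (V := V) hlow n).2
      have h0 : coeff 0 V = aMat n := by rw [hV, coeff_qSeries, Q_zero]
      rw [h0] at h1
      rw [← h1, hW, leibnizSum_add, leibnizSum_commutator, leibnizSum_mul_left _ _ _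
        (X_mul (φ := V)), map_add, coeff_succ_X_mul, hzero, zero_add, hcomm, ih1 j le_rfl]
      have : u p * coeff j (1 : (Mat n)⟦X⟧) - coeff j (1 : (Mat n)⟦X⟧) * u p = 0 := by
        rw [coeff_one]; split_ifs <;> simp
      rw [this, add_zero]
    have hoff : ∀ r s, r ≠ s → coeff (j + 1) W r s = 0 := by
      intro r s hrs
      rw [hWs, Matrix.sub_apply, Q_succ_commutator_off u j p hrs, sub_self]
    have hWz : coeff (j + 1) W = 0 := by
      ext r s
      by_cases hrs : r = s
      · subst hrs
        have h := congrFun (congrFun hkey r) r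
        rw [leibnizSum_aMat_diag, ← neg_sub, Matrix.neg_apply, commutator_aMat_apply, sub_self,
          mul_zero, neg_zero] at h
        have ha : aMat n r r ^ (n - 1) ≠ 0 := left_ne_zero_of_mul_eq_one (aMat_diag_pow r)
        exact (mul_eq_zero.1 h).resolve_left (mul_ne_zero hn ha)
      · exact hoff r s hrs
    -- With W = 0 at this order the coefficient commutes with a, so it is diagonal; its diagonal
    -- vanishes by the choice of Q.
    have hP : coeff (j + 1) (V ^ n) = 0 := by
      rw [hWz] at hkey
      ext r s
      by_cases hrs : r = s
      · subst hrs
        rw [coeff_pow_diag u j p (fun i _ => coeff_qSeries u p i), coeff_qSeries, sub_self,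
          mul_zero]
        rfl
      · have hz : leibnizSum (aMat n) (0 : Mat n) n = 0 := by
          rw [leibnizSum_of_commute _ _ (Commute.zero_right _)]; simp
        have h := congrFun (congrFun hkey r) s
        rw [hz, ← neg_sub, Matrix.neg_apply, commutator_aMat_apply] at h
        exact (mul_eq_zero.1 (neg_eq_zero.1 h.symm)).resolve_right (aMat_apply_ne (Ne.symm hrs))
    refine ⟨fun i hi => ?_, fun i hi => ?_⟩
    · rcases Nat.lt_or_eq_of_le hi with h | h
      · exact ih1 i (by omega)
      · rw [h, hP, coeff_one, if_neg (Nat.succ_ne_zero j)]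
    · rcases Nat.lt_or_eq_of_le (Nat.lt_succ_iff.1 hi) with h | h
      · exact ih2 i h
      · rw [h]
        exact sub_eq_zero.1 ((hWs j).symm.trans hWz)

theorem qSeries_pow [NeZero n] {O : Set (ℝ × ℝ)} (hO : IsOpen O) {u : ℝ × ℝ → Mat n}
    (hu : ContDiffOn ℝ ∞ u O) {p : ℝ × ℝ} (hp : p ∈ O) : qSeries u p ^ n = 1 := by
  ext1 j
  exact (hierarchy_aux hO hu j p hp).1 j le_rfl

theorem Q_recursion [NeZero n] {O : Set (ℝ × ℝ)} (hO : IsOpen O) {u : ℝ × ℝ → Mat n}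
    (hu : ContDiffOn ℝ ∞ u O) {p : ℝ × ℝ} (hp : p ∈ O) (j : ℕ) :
    dx (Q u j) p + (u p * Q u j p - Q u j p * u p) =
      Q u (j + 1) p * aMat n - aMat n * Q u (j + 1) p :=
  (hierarchy_aux hO hu (j + 1) p hp).2 j (Nat.lt_succ_self j)

/-- The recursion together with `V ^ n = 1` determines the series. -/
theorem coeff_eq_Q_of_recursion [NeZero n] {O : Set (ℝ × ℝ)} (hO : IsOpen O)
    {u : ℝ × ℝ → Mat n} {F : ℝ × ℝ → (Mat n)⟦X⟧} (h0 : ∀ p ∈ O, coeff 0 (F p) = aMat n)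
    (hpow : ∀ p ∈ O, F p ^ n = 1)
    (hrec : ∀ j, ∀ p ∈ O, dx (fun q => coeff j (F q)) p +
      (u p * coeff j (F p) - coeff j (F p) * u p) =
        coeff (j + 1) (F p) * aMat n - aMat n * coeff (j + 1) (F p)) (j : ℕ) :
    ∀ p ∈ O, coeff j (F p) = Q u j p := by
  have hn : (n : ℂ) ≠ 0 := Nat.cast_ne_zero.2 (NeZero.ne n)
  induction j using Nat.strong_induction_on with
  | _ j ih =>
    intro p hp
    rcases j with _ | j
    · rw [h0 p hp, Q_zero]
    · ext r s
      by_cases hrs : r = s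
      · subst hrs
        have h := coeff_pow_diag u j p (F := F p) (fun i hi => ih i (by omega) p hp) r
        rw [hpow p hp, coeff_one, if_neg (Nat.succ_ne_zero j), Matrix.zero_apply, eq_comm] at h
        have ha : aMat n r r ^ (n - 1) ≠ 0 := left_ne_zero_of_mul_eq_one (aMat_diag_pow r)
        exact sub_eq_zero.1 ((mul_eq_zero.1 h).resolve_left (mul_ne_zero hn ha))
      · have h1 := congrFun (congrFun (hrec j p hp) r) s
        have h2 := Q_succ_commutator_off u j p hrs
        have hj := ih j (Nat.lt_succ_self j)
        rw [dx_congr hO hj hp, hj p hp, ← h2, commutator_aMat_apply, commutator_aMat_apply] at h1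
        exact (mul_right_cancel₀ (aMat_apply_ne (Ne.symm hrs)) h1).symm

end Hierarchy

/-! ### Gauge action of a + YX on the hierarchy -/

section Darboux

attribute [local instance] Matrix.linftyOpNormedRing Matrix.linftyOpNormedAlgebra

open PowerSeries

variable {n : ℕ} {O : Set (ℝ × ℝ)} {u Y : ℝ × ℝ → Mat n}

/-- The symmetry `τ⁻¹ Q_{a,j} τ = α^(1-j) Q_{a,j}`. -/
theorem tauConj_Q [NeZero n] (hO : IsOpen O) (hu : ContDiffOn ℝ ∞ u O)
    (hτ : ∀ p ∈ O, tauConj n (u p) = u p) (j : ℕ) {p : ℝ × ℝ} (hp : p ∈ O) :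
    root n ^ j • tauConj n (Q u j p) = root n • Q u j p := by
  -- Conjugation by τ multiplies a by α. The substitution X ↦ αX and the prefactor α⁻¹ restore the
  -- recursion and the leading coefficient; F^n = 1 persists because α^{-n} = 1.
  set F : ℝ × ℝ → (Mat n)⟦X⟧ := fun q => PowerSeries.mk fun i =>
    ((root n)⁻¹ * root n ^ i) • tauConj n (Q u i q) with hF
  have hcF : ∀ q i, coeff i (F q) = ((root n)⁻¹ * root n ^ i) • tauConj n (Q u i q) :=
    fun q i => coeff_mk _ _
  have key := coeff_eq_Q_of_recursion (F := F) (u := u) hO ?_ ?_ ?_ j p hp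
  · conv_rhs => rw [← key]
    rw [hcF, smul_smul, ← mul_assoc, mul_inv_cancel₀ root_ne_zero, one_mul]
  · intro q _
    rw [hcF, Q_zero, tauConj_aMat, smul_smul, pow_zero, mul_one, inv_mul_cancel₀ root_ne_zero,
      one_smul]
  · intro q hq
    ext1 m
    rw [coeff_pow_semilinear (tauConj n) (root n)⁻¹ (root n) (G := qSeries u q)
      (fun m => by rw [hcF, coeff_qSeries]), qSeries_pow hO hu hq, inv_pow, root_pow_self,
      inv_one, one_mul, coeff_one]
    split_ifs with h
    · simp [h]
    · simp
  · intro i q hq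
    have hd : dx (fun q => coeff i (F q)) q =
        ((root n)⁻¹ * root n ^ i) • tauConj n (dx (Q u i) q) := by
      have h := hasDerivAt_dx hO (contDiffOn_Q hO hu i) hq
      simp only [hcF]
      exact ((h.const_mul ((tau n)⁻¹)).mul_const (tau n)).const_smul
        ((root n)⁻¹ * root n ^ i) |>.deriv
    have h := congrArg (fun y => ((root n)⁻¹ * root n ^ i) • tauConj n y)
      (Q_recursion hO hu hq i)
    simp only [map_add, map_sub, map_mul, hτ q hq, tauConj_aMat] at h
    rw [hd, hcF, hcF]
    simp only [Matrix.mul_smul, Matrix.smul_mul, smul_add, smul_sub, smul_smul] at h ⊢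
    rw [h, pow_succ, mul_assoc]

/-- The definition of ũ cleared of a⁻¹: the order X part of the gauge relation between u and ũ. -/
theorem transform_mul_aMat (p : ℝ × ℝ) :
    transform u Y p * aMat n = aMat n * u p + (Y p * aMat n - aMat n * Y p) := by
  rw [transform, Matrix.add_mul, Matrix.mul_assoc, aMat_inv_mul, Matrix.mul_one,
    Matrix.mul_assoc, aMat_inv_mul, Matrix.mul_one]

theorem contDiffOn_transform (hu : ContDiffOn ℝ ∞ u O) (hY : ContDiffOn ℝ ∞ Y O) :
    ContDiffOn ℝ ∞ (transform u Y) O :=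
  ((contDiffOn_const.mul hu).mul contDiffOn_const).add
    (((hY.mul contDiffOn_const).sub (contDiffOn_const.mul hY)).mul contDiffOn_const)

/-- The dressing series `a + Y X`. -/
noncomputable def dressing (y : Mat n) : (Mat n)⟦X⟧ := C (aMat n) + X * C y

/-- The inverse of the dressing series. -/
noncomputable def dressingInv (y : Mat n) : (Mat n)⟦X⟧ :=
  PowerSeries.mk (fun i => (-((aMat n)⁻¹ * y)) ^ i) * C (aMat n)⁻¹

theorem dressing_eq (y : Mat n) :
    dressing y = C (aMat n) * (1 - X * C (-((aMat n)⁻¹ * y))) := by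
  have : y = aMat n * ((aMat n)⁻¹ * y) := by rw [← Matrix.mul_assoc, aMat_mul_inv, Matrix.one_mul]
  rw [dressing, mul_sub, mul_one, ← mul_assoc, ← X_mul, mul_assoc, ← map_mul, mul_neg, ← this,
    map_neg, mul_neg, sub_neg_eq_add]

theorem geom_series_inverse {R : Type*} [Ring R] (m : R) :
    (1 - X * C m) * PowerSeries.mk (fun i => m ^ i) = 1 ∧
      PowerSeries.mk (fun i => m ^ i) * (1 - X * C m) = 1 := by
  constructor <;> ext i
  · rw [sub_mul, one_mul, mul_assoc, map_sub]
    rcases i with _ | i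
    · simp
    · rw [coeff_succ_X_mul, coeff_C_mul, coeff_mk, coeff_mk, pow_succ', sub_self, coeff_one,
        if_neg (Nat.succ_ne_zero i)]
  · rw [mul_sub, mul_one, ← mul_assoc, ← X_mul, mul_assoc, map_sub]
    rcases i with _ | i
    · simp
    · rw [coeff_succ_X_mul, coeff_mul_C, coeff_mk, coeff_mk, pow_succ, sub_self, coeff_one,
        if_neg (Nat.succ_ne_zero i)]

theorem dressing_mul_inv (y : Mat n) : dressing y * dressingInv y = 1 := by
  rw [dressing_eq, dressingInv, mul_assoc, ← mul_assoc (1 - _), (geom_series_inverse _).1, one_mul,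
    ← map_mul, aMat_mul_inv, map_one]

theorem dressingInv_mul (y : Mat n) : dressingInv y * dressing y = 1 := by
  rw [dressing_eq, dressingInv, mul_assoc, ← mul_assoc (C (aMat n)⁻¹), ← map_mul, aMat_inv_mul,
    map_one, one_mul, (geom_series_inverse _).2]

theorem contDiffOn_coeff_dressing (hY : ContDiffOn ℝ ∞ Y O) (m : ℕ) :
    ContDiffOn ℝ ∞ (fun p => coeff m (dressing (Y p))) O := by
  simp only [dressing, map_add]
  refine contDiffOn_const.add ?_
  rcases m with _ | m
  · simp only [coeff_zero_X_mul]
    exact contDiffOn_const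
  · simp only [coeff_succ_X_mul, coeff_C]
    split_ifs
    · exact hY
    · exact contDiffOn_const

theorem contDiffOn_coeff_dressingInv (hY : ContDiffOn ℝ ∞ Y O) (m : ℕ) :
    ContDiffOn ℝ ∞ (fun p => coeff m (dressingInv (Y p))) O := by
  simp only [dressingInv, coeff_mul_C, coeff_mk]
  exact (((contDiffOn_const.mul hY).neg).pow m).mul contDiffOn_const

/-- Flatness of the series with coefficients `q_j`, in generating form. -/
theorem series_flat_iff {R : Type*} [Ring R] {a w : R} {F F' : R⟦X⟧} :
    X * F' + ((C a + X * C w) * F - F * (C a + X * C w)) = 0 ↔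
      a * coeff 0 F - coeff 0 F * a = 0 ∧ ∀ j, coeff j F' + (w * coeff j F - coeff j F * w) =
        coeff (j + 1) F * a - a * coeff (j + 1) F := by
  have h0 : coeff 0 (X * F' + ((C a + X * C w) * F - F * (C a + X * C w))) =
      a * coeff 0 F - coeff 0 F * a := by
    have hlt : ∀ (G : R⟦X⟧), ∀ i < 0, coeff i G = 0 := fun _ i hi => absurd hi (by simp)
    have hA0 : coeff 0 (C a + X * C w) = a := by simp
    rw [map_add, coeff_zero_X_mul, map_sub, coeff_mul_of_low_left (hlt (C a + X * C w)),
      coeff_mul_of_low_left (hlt F), hA0, zero_add]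
  have hs : ∀ j, coeff (j + 1) (X * F' + ((C a + X * C w) * F - F * (C a + X * C w))) =
      coeff j F' + (w * coeff j F - coeff j F * w) -
        (coeff (j + 1) F * a - a * coeff (j + 1) F) := by
    intro j
    rw [map_add, coeff_succ_X_mul, coeff_succ_commutator]
    abel
  constructor
  · intro h
    refine ⟨by rw [← h0, h, map_zero], fun j => ?_⟩
    rw [← sub_eq_zero, ← hs, h, map_zero]
  · rintro ⟨h1, h2⟩
    ext j
    rcases j with _ | j
    · rw [h0, h1, map_zero]
    · rw [hs, h2, sub_self, map_zero]

/-- If `Y_x = Y u - ũ Y`, conjugation by the dressing series carries the hierarchy of `u` to that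
of `ũ`. -/
theorem qSeries_transform_mul [NeZero n] (hO : IsOpen O) (hu : ContDiffOn ℝ ∞ u O)
    (hY : ContDiffOn ℝ ∞ Y O)
    (hYx : ∀ p ∈ O, dx Y p = Y p * u p - transform u Y p * Y p) {p : ℝ × ℝ} (hp : p ∈ O) :
    qSeries (transform u Y) p * dressing (Y p) = dressing (Y p) * qSeries u p := by
  set F : ℝ × ℝ → (Mat n)⟦X⟧ := fun q => dressing (Y q) * qSeries u q * dressingInv (Y q) with hF
  have hFπ : ∀ q, F q * dressing (Y q) = dressing (Y q) * qSeries u q := fun q => by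
    rw [hF, mul_assoc, dressingInv_mul, mul_one]
  have hFs : ∀ m, ContDiffOn ℝ ∞ (fun q => coeff m (F q)) O :=
    contDiffOn_coeff_mul (contDiffOn_coeff_mul (contDiffOn_coeff_dressing hY)
      (fun m => by simpa only [coeff_qSeries] using contDiffOn_Q hO hu m))
      (contDiffOn_coeff_dressingInv hY)
  have hflat : ∀ q ∈ O, X * (PowerSeries.mk fun m => dx (fun q => coeff m (F q)) q) +
      ((C (aMat n) + X * C (transform u Y q)) * F q -
        F q * (C (aMat n) + X * C (transform u Y q))) = 0 := by
    intro q hq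
    set F' : (Mat n)⟦X⟧ := PowerSeries.mk fun m => dx (fun q => coeff m (F q)) q with hF'
    set V' : (Mat n)⟦X⟧ := PowerSeries.mk fun m => dx (Q u m) q with hV'
    set A : (Mat n)⟦X⟧ := C (aMat n) + X * C (u q) with hA
    set At : (Mat n)⟦X⟧ := C (aMat n) + X * C (transform u Y q) with hAt
    set π := dressing (Y q) with hπ
    set V := qSeries u q with hV
    have dF : HasCoeffDerivAt (fun s => F (s, q.2)) F' q.1 := fun m => by
      rw [hF', coeff_mk]
      exact hasDerivAt_dx hO (hFs m) hq
    have dV : HasCoeffDerivAt (fun s => qSeries u (s, q.2)) V' q.1 := fun m => by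
      simp only [hV', coeff_mk, coeff_qSeries]
      exact hasDerivAt_dx hO (contDiffOn_Q hO hu m) hq
    have dπ : HasCoeffDerivAt (fun s => dressing (Y (s, q.2))) (X * C (dx Y q)) q.1 := fun m => by
      simp only [dressing, map_add]
      refine HasDerivAt.const_add _ ?_
      rcases m with _ | m
      · simp only [coeff_zero_X_mul]
        exact hasDerivAt_const _ _
      · simp only [coeff_succ_X_mul, coeff_C]
        split_ifs
        · exact hasDerivAt_dx hO hY hq
        · exact hasDerivAt_const _ _
    have hd : F' * π + F q * (X * C (dx Y q)) = X * C (dx Y q) * V + π * V' := by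
      ext1 m
      have h1 := (dF.mul dπ) m
      have h2 := (dπ.mul dV) m
      simp only [hFπ] at h1
      exact h1.unique h2
    have hXV : X * V' = V * A - A * V := by
      have h : X * V' + (A * V - V * A) = 0 := by
        refine series_flat_iff.2 ⟨?_, fun j => ?_⟩
        · rw [hV, coeff_qSeries, Q_zero, sub_self]
        · rw [hV', coeff_mk, hV, coeff_qSeries, coeff_qSeries]
          exact Q_recursion hO hu hq j
      rw [eq_neg_of_add_eq_zero_left h, neg_sub]
    -- Gauge relation for π = a + YX: order 0 is trivial, order 1 is the definition of ũ, order 2 is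
    -- the hypothesis on Y_x.
    have hXπ : X * (X * C (dx Y q)) = π * A - At * π := by
      have hX : ∀ G : (Mat n)⟦X⟧, G * X = X * G := fun G => X_mul.symm
      have ht : C (transform u Y q) * C (aMat n) = C (aMat n) * C (u q) +
          (C (Y q) * C (aMat n) - C (aMat n) * C (Y q)) := by
        simp only [← map_mul, ← map_sub, ← map_add, transform_mul_aMat]
      rw [hYx q hq, hπ, dressing, hA, hAt, map_sub, map_mul, map_mul]
      simp only [add_mul, mul_add, mul_sub, mul_assoc]
      simp only [← mul_assoc (C (aMat n)) X, ← mul_assoc (C (Y q)) X,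
        ← mul_assoc (C (transform u Y q)) X, hX, mul_assoc, ht, mul_add, mul_sub]
      abel
    -- The flatness defect of F is computed after right multiplication by the invertible π, so that
    -- the derivative of π⁻¹ never appears.
    have hfin : (X * F' + (At * F q - F q * At)) * π = 0 := by
      have e1 : X * F' * π = (π * A - At * π) * V + π * (V * A - A * V) -
          F q * (π * A - At * π) := by
        rw [mul_assoc, eq_sub_of_add_eq hd, mul_sub, mul_add, ← hXV, ← hXπ]
        rw [← mul_assoc X (F q), X_mul (φ := F q), ← mul_assoc X π, X_mul (φ := π)]
        simp only [mul_assoc]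
      have e2 : F q * π = π * V := hFπ q
      calc (X * F' + (At * F q - F q * At)) * π
          = X * F' * π + At * (F q * π) - F q * At * π := by noncomm_ring
        _ = π * V * A - F q * (π * A) := by rw [e1, e2]; noncomm_ring
        _ = 0 := by rw [← mul_assoc (F q), e2, sub_self]
    calc _ = (X * F' + (At * F q - F q * At)) * (π * dressingInv (Y q)) := by
          rw [dressing_mul_inv, mul_one]
      _ = 0 := by rw [← mul_assoc, hfin, zero_mul]
  have hFQ : F p = qSeries (transform u Y) p := by
    ext1 j
    rw [coeff_qSeries]
    refine coeff_eq_Q_of_recursion (F := F) hO ?_ ?_ ?_ j p hp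
    · intro q _
      simp [hF, dressing, dressingInv, qSeries, Q_zero, aMat_mul_inv, Matrix.mul_assoc]
    · intro q hq
      have h : ∀ N : ℕ, F q ^ N * dressing (Y q) = dressing (Y q) * qSeries u q ^ N := by
        intro N
        induction N with
        | zero => simp
        | succ N ih => rw [pow_succ', mul_assoc, ih, ← mul_assoc, hFπ, mul_assoc, pow_succ']
      have h2 := h n
      rw [qSeries_pow hO hu hq, mul_one] at h2
      calc F q ^ n = F q ^ n * (dressing (Y q) * dressingInv (Y q)) := by
            rw [dressing_mul_inv, mul_one]
        _ = 1 := by rw [← mul_assoc, h2, dressing_mul_inv]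
    · intro j q hq
      have h := (series_flat_iff.1 (hflat q hq)).2 j
      rwa [coeff_mk] at h
  rw [← hFQ, hFπ]

/-- The coefficient of X^{j+1} in Ṽ(a + YX) = (a + YX)V. -/
theorem Q_transform_relation [NeZero n] (hO : IsOpen O) (hu : ContDiffOn ℝ ∞ u O)
    (hY : ContDiffOn ℝ ∞ Y O)
    (hYx : ∀ p ∈ O, dx Y p = Y p * u p - transform u Y p * Y p) {p : ℝ × ℝ} (hp : p ∈ O)
    (j : ℕ) :
    Q (transform u Y) (j + 1) p * aMat n + Q (transform u Y) j p * Y p =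
      aMat n * Q u (j + 1) p + Y p * Q u j p := by
  have h := congrArg (coeff (j + 1)) (qSeries_transform_mul hO hu hY hYx hp)
  rw [dressing, mul_add, add_mul, map_add, map_add, coeff_mul_C, coeff_C_mul, mul_assoc X,
    coeff_succ_X_mul, coeff_C_mul, ← mul_assoc, ← X_mul, mul_assoc, coeff_succ_X_mul, coeff_mul_C]
    at h
  simpa only [coeff_qSeries] using h

end Darboux

/-! ### Total linear differential equations on the plane: uniqueness and limits -/

section TotalODE

open Filter Topology

set_option linter.unusedSectionVars false

variable {W X ι : Type*} [NormedAddCommGroup W] [NormedSpace ℝ W] [NormedAddCommGroup X]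
  [NormedSpace ℝ X]

/-- Taking K ≥ 1 costs nothing and avoids the separate formula of the bound at K = 0. -/
theorem gronwallBound_one_le {δ K ε : ℝ} (hK : 1 ≤ K) (hε : 0 ≤ ε) :
    gronwallBound δ K ε 1 ≤ (δ + ε) * Real.exp K := by
  have hK0 : K ≠ 0 := by linarith
  rw [gronwallBound_of_K_ne_0 hK0]
  simp only [mul_one]
  have h1 : ε / K ≤ ε := div_le_self hε hK
  have h2 : 0 ≤ Real.exp K - 1 := by
    have := Real.add_one_le_exp K
    linarith
  have h3 : ε / K * (Real.exp K - 1) ≤ ε * (Real.exp K - 1) := mul_le_mul_of_nonneg_right h1 h2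
  linarith

/-- Grönwall's inequality on a convex set of diameter at most one. -/
theorem norm_le_of_norm_fderiv_le {P : Type*} [NormedAddCommGroup P] [NormedSpace ℝ P]
    {s : Set P} (hs : Convex ℝ s) {F : P → X}
    {F' : P → P →L[ℝ] X} (hF : ∀ p ∈ s, HasFDerivAt F (F' p) p) {K ε : ℝ} (hK : 1 ≤ K)
    (hε : 0 ≤ ε) (hb : ∀ p ∈ s, ∀ w, ‖F' p w‖ ≤ (K * ‖F p‖ + ε) * ‖w‖) {x y : P} (hx : x ∈ s)
    (hy : y ∈ s) (hxy : ‖y - x‖ ≤ 1) : ‖F y‖ ≤ (‖F x‖ + ε) * Real.exp K := by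
  -- The one-variable Grönwall inequality is applied along the segment from x to y, over unit time.
  set γ : ℝ → P := fun t => x + t • (y - x) with hγ
  have hmem : ∀ t ∈ Set.Icc (0 : ℝ) 1, γ t ∈ s := fun t ht =>
    hs.add_smul_sub_mem hx hy ht
  have hder : ∀ t ∈ Set.Icc (0 : ℝ) 1, HasDerivAt (fun t => F (γ t)) (F' (γ t) (y - x)) t := by
    intro t ht
    have h1 : HasDerivAt γ ((1 : ℝ) • (y - x)) t :=
      ((hasDerivAt_id t).smul_const (y - x)).const_add x
    rw [one_smul] at h1
    exact (hF _ (hmem t ht)).comp_hasDerivAt t h1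
  have h := norm_le_gronwallBound_of_norm_deriv_right_le (f := fun t => F (γ t))
    (f' := fun t => F' (γ t) (y - x)) (δ := ‖F x‖) (K := K) (ε := ε) (a := 0) (b := 1)
    (fun t ht => (hder t ht).continuousAt.continuousWithinAt)
    (fun t ht => (hder t ⟨ht.1, ht.2.le⟩).hasDerivWithinAt) (by simp [hγ])
    (fun t ht => by
      have hm := hmem t ⟨ht.1, ht.2.le⟩
      calc ‖F' (γ t) (y - x)‖ ≤ (K * ‖F (γ t)‖ + ε) * ‖y - x‖ := hb _ hm _
        _ ≤ (K * ‖F (γ t)‖ + ε) * 1 := mul_le_mul_of_nonneg_left hxy (by positivity)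
        _ ≤ _ := by rw [mul_one]) 1 (by simp)
  have hend : γ 1 = y := by simp [hγ]
  simp only [hend, sub_zero] at h
  exact h.trans (gronwallBound_one_le hK hε)

/-- A property that propagates inside a neighbourhood of each point of a preconnected set
holds everywhere as soon as it holds somewhere. -/
theorem propagate_of_locally {α : Type*} [TopologicalSpace α] {O : Set α}
    (hc : IsPreconnected O) (q : α → Prop)
    (h : ∀ x ∈ O, ∃ U ∈ 𝓝 x, ∀ y ∈ U, ∀ z ∈ U, q y → q z) {x y : α} (hx : x ∈ O) (hy : y ∈ O)
    (hq : q x) : q y := by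
  refine hc.induction₂' (fun a b => q a → q b) (fun a ha => ?_)
    (fun _ _ _ _ _ _ h1 h2 h3 => h2 (h1 h3)) hx hy hq
  obtain ⟨U, hU, hUq⟩ := h a ha
  filter_upwards [mem_nhdsWithin_of_mem_nhds hU] with b hb
  exact ⟨hUq a (mem_of_mem_nhds hU) b hb, hUq b hb a (mem_of_mem_nhds hU)⟩

/-- The linear form `(h, k) ↦ h • x + k • y`. -/
noncomputable def planeForm (x y : X) : ℝ × ℝ →L[ℝ] X :=
  (ContinuousLinearMap.fst ℝ ℝ ℝ).smulRight x + (ContinuousLinearMap.snd ℝ ℝ ℝ).smulRight y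

theorem planeForm_apply (x y : X) (w : ℝ × ℝ) : planeForm x y w = w.1 • x + w.2 • y := rfl

theorem planeForm_sub (x y x' y' : X) :
    planeForm x y - planeForm x' y' = planeForm (x - x') (y - y') := by
  ext <;> simp [planeForm_apply]

theorem norm_planeForm_apply_le (x y : X) (w : ℝ × ℝ) :
    ‖planeForm x y w‖ ≤ (‖x‖ + ‖y‖) * ‖w‖ := by
  rw [planeForm_apply]
  have h1 : ‖w.1‖ ≤ ‖w‖ := norm_fst_le w
  have h2 : ‖w.2‖ ≤ ‖w‖ := norm_snd_le w
  calc ‖w.1 • x + w.2 • y‖ ≤ ‖w.1 • x‖ + ‖w.2 • y‖ := norm_add_le _ _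
    _ = ‖w.1‖ * ‖x‖ + ‖w.2‖ * ‖y‖ := by rw [norm_smul, norm_smul]
    _ ≤ ‖w‖ * ‖x‖ + ‖w‖ * ‖y‖ := by gcongr
    _ = _ := by ring

theorem norm_sub_le_one_of_mem {P : Type*} [SeminormedAddCommGroup P] {x y z : P} {r : ℝ}
    (hr : r ≤ 1 / 2) (hy : y ∈ Metric.closedBall x r) (hz : z ∈ Metric.closedBall x r) :
    ‖z - y‖ ≤ 1 := by
  rw [← dist_eq_norm]
  have := dist_triangle_right z y x
  rw [Metric.mem_closedBall] at hy hz
  linarith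

/-- Radius at most 1/2 keeps the diameter at most 1, as the Grönwall estimate on a convex set
requires. -/
theorem exists_closedBall_subset {P : Type*} [PseudoMetricSpace P] {O : Set P} (hO : IsOpen O)
    {x : P} (hx : x ∈ O) : ∃ r > 0, r ≤ 1 / 2 ∧ Metric.closedBall x r ⊆ O := by
  obtain ⟨r, hr, hrO⟩ := Metric.nhds_basis_closedBall.mem_iff.1 (hO.mem_nhds hx)
  exact ⟨min r (1 / 2), lt_min hr (by norm_num), min_le_right _ _,
    (Metric.closedBall_subset_closedBall (min_le_left _ _)).trans hrO⟩

/-- `F` solves the total linear differential equation `F_x = β(F, A)`, `F_t = β(F, V)` on `s`. -/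
def SolvesOn (β : X → W → X) (A V : ℝ × ℝ → W) (F : ℝ × ℝ → X) (s : Set (ℝ × ℝ)) : Prop :=
  ∀ p ∈ s, HasFDerivAt F (planeForm (β (F p) (A p)) (β (F p) (V p))) p

variable {β : X → W → X} (hβ : IsBoundedBilinearMap ℝ fun p : X × W => β p.1 p.2)
  {O : Set (ℝ × ℝ)} {A₀ V₀ : ℝ × ℝ → W}

theorem SolvesOn.mono {F : ℝ × ℝ → X} {s t : Set (ℝ × ℝ)} (h : SolvesOn β A₀ V₀ F t)
    (hst : s ⊆ t) : SolvesOn β A₀ V₀ F s := fun p hp => h p (hst hp)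

theorem norm_add_norm_le_of_bound {C K : ℝ} (hC : ∀ x w, ‖β x w‖ ≤ C * ‖x‖ * ‖w‖) (hC0 : 0 < C)
    {a w : W} (ha : ‖a‖ ≤ K) (hw : ‖w‖ ≤ K) (x : X) :
    ‖β x a‖ + ‖β x w‖ ≤ 2 * C * K * ‖x‖ := by
  have h1 := (hC x a).trans (mul_le_mul_of_nonneg_left ha (by positivity))
  have h2 := (hC x w).trans (mul_le_mul_of_nonneg_left hw (by positivity))
  linarith

include hβ in
/-- Uniqueness for total linear differential equations. -/
theorem SolvesOn.eq_zero (hO : IsOpen O) (hc : IsPreconnected O) (hA : ContinuousOn A₀ O)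
    (hV : ContinuousOn V₀ O) {F : ℝ × ℝ → X} (hF : SolvesOn β A₀ V₀ F O) {x y : ℝ × ℝ}
    (hx : x ∈ O) (hy : y ∈ O) (h0 : F x = 0) : F y = 0 := by
  obtain ⟨C, hC0, hC⟩ := hβ.bound
  refine propagate_of_locally hc (fun p => F p = 0) (fun c hcO => ?_) hx hy h0
  obtain ⟨r, hr, hr2, hsub⟩ := exists_closedBall_subset hO hcO
  obtain ⟨K₁, hK₁⟩ := (isCompact_closedBall c r).exists_bound_of_continuousOn (hA.mono hsub)
  obtain ⟨K₂, hK₂⟩ := (isCompact_closedBall c r).exists_bound_of_continuousOn (hV.mono hsub)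
  refine ⟨_, Metric.closedBall_mem_nhds c hr, fun a ha b hb h0 => ?_⟩
  have h := norm_le_of_norm_fderiv_le (convex_closedBall c r) (hF.mono hsub)
    (K := max (2 * C * max K₁ K₂) 1) (ε := 0) (le_max_right _ _) le_rfl (fun p hp w => ?_) ha hb
    (norm_sub_le_one_of_mem hr2 ha hb)
  · rw [h0, norm_zero, add_zero, zero_mul] at h
    exact norm_le_zero_iff.1 h
  · rw [add_zero]
    refine (norm_planeForm_apply_le _ _ w).trans (mul_le_mul_of_nonneg_right ?_ (norm_nonneg w))
    exact (norm_add_norm_le_of_bound hC hC0 ((hK₁ p hp).trans (le_max_left _ _))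
      ((hK₂ p hp).trans (le_max_right _ _)) (F p)).trans
      (mul_le_mul_of_nonneg_right (le_max_left _ _) (norm_nonneg _))

variable {l : Filter ι} {A V : ι → ℝ × ℝ → W} {F : ι → ℝ × ℝ → X}

theorem eventually_norm_le_of_tendstoUniformlyOn {P : Type*} {s : Set P} {G : ι → P → W}
    {G₀ : P → W} (h : TendstoUniformlyOn G G₀ l s) {K : ℝ} (hK : ∀ p ∈ s, ‖G₀ p‖ ≤ K) :
    ∀ᶠ μ in l, ∀ p ∈ s, ‖G μ p‖ ≤ K + 1 := by
  filter_upwards [Metric.tendstoUniformlyOn_iff.1 h 1 one_pos] with μ hμ p hp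
  have h3 := hμ p hp
  rw [dist_eq_norm, norm_sub_rev] at h3
  have h4 := norm_le_norm_add_norm_sub' (G μ p) (G₀ p)
  have h5 := hK p hp
  linarith

include hβ in
/-- Solutions of a uniformly convergent family of total linear differential equations, convergent
at one point, are eventually uniformly bounded and uniformly Cauchy nearby. -/
theorem uniformCauchySeqOn_of_family {s : Set (ℝ × ℝ)} (hs : Convex ℝ s)
    (hdiam : ∀ x ∈ s, ∀ y ∈ s, ‖y - x‖ ≤ 1) {K : ℝ} (hKA : ∀ p ∈ s, ‖A₀ p‖ ≤ K)
    (hKV : ∀ p ∈ s, ‖V₀ p‖ ≤ K) (hA : TendstoUniformlyOn A A₀ l s)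
    (hV : TendstoUniformlyOn V V₀ l s)
    (hF : ∀ᶠ μ in l, SolvesOn β (A μ) (V μ) (F μ) s) {x : ℝ × ℝ} (hx : x ∈ s) {L : X}
    (hL : Tendsto (fun μ => F μ x) l (𝓝 L)) :
    (∃ M, ∀ᶠ μ in l, ∀ p ∈ s, ‖F μ p‖ ≤ M) ∧ UniformCauchySeqOn F l s := by
  obtain ⟨C, hC0, hC⟩ := hβ.bound
  set K' := max (2 * C * (K + 1)) 1 with hK'
  set M := (‖L‖ + 1) * Real.exp K' with hM
  have hM0 : 0 < M := by positivity
  have hbA := eventually_norm_le_of_tendstoUniformlyOn hA hKA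
  have hbV := eventually_norm_le_of_tendstoUniformlyOn hV hKV
  have hbF : ∀ᶠ μ in l, ∀ p ∈ s, ‖F μ p‖ ≤ M := by
    have h1 : ∀ᶠ μ in l, ‖F μ x‖ < ‖L‖ + 1 := hL.norm.eventually_lt_const (lt_add_one _)
    filter_upwards [hF, h1, hbA, hbV] with μ hμ h1 hA' hV' p hp
    have h := norm_le_of_norm_fderiv_le hs hμ (K := K') (ε := 0) (le_max_right _ _)
      le_rfl (fun q hq w => by
        rw [add_zero]
        refine (norm_planeForm_apply_le _ _ w).trans
          (mul_le_mul_of_nonneg_right ?_ (norm_nonneg w))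
        exact (norm_add_norm_le_of_bound hC hC0 (hA' q hq) (hV' q hq) (F μ q)).trans
          (mul_le_mul_of_nonneg_right (le_max_left _ _) (norm_nonneg _)))
      hx hp (hdiam x hx p hp)
    rw [add_zero] at h
    exact h.trans (mul_le_mul_of_nonneg_right h1.le (Real.exp_pos _).le)
  refine ⟨⟨M, hbF⟩, fun U hU => ?_⟩
  obtain ⟨ε, hε, hεU⟩ := Metric.mem_uniformity_dist.1 hU
  -- The final bound is (2δ + δ) exp K' = 3ε/4: 2δ from the values at x, δ from the difference of
  -- the coefficients.
  set δ := ε / (4 * Real.exp K') with hδ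
  have hδ0 : 0 < δ := by positivity
  -- Coefficients within η of their limits differ by at most 2η, contributing C M · 2η = δ/2 in each
  -- of the two directions.
  set η := δ / (4 * C * M) with hη
  have hη0 : 0 < η := by positivity
  have e1 := Metric.tendstoUniformlyOn_iff.1 hA η hη0
  have e2 := Metric.tendstoUniformlyOn_iff.1 hV η hη0
  have e3 := Metric.tendsto_nhds.1 hL δ hδ0
  have hall := ((hF.and hbF).and (hbA.and hbV)).and ((e1.and e2).and e3)
  filter_upwards [hall.prod_mk hall] with μν hμν p hp
  obtain ⟨⟨⟨⟨hFμ, -⟩, hAμ, hVμ⟩, ⟨e1μ, e2μ⟩, e3μ⟩, ⟨⟨hFν, hMν⟩, -⟩, ⟨e1ν, e2ν⟩, e3ν⟩ := hμν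
  obtain ⟨μ, ν⟩ := μν
  have hclose : ∀ {G : ι → ℝ × ℝ → W} {G₀ : ℝ × ℝ → W}, (∀ q ∈ s, dist (G₀ q) (G μ q) < η) →
      (∀ q ∈ s, dist (G₀ q) (G ν q) < η) → ∀ q ∈ s, ‖G μ q - G ν q‖ ≤ 2 * η := by
    intro G G₀ h1 h2 q hq
    rw [← dist_eq_norm]
    have := dist_triangle_left (G μ q) (G ν q) (G₀ q)
    have := h1 q hq
    have := h2 q hq
    linarith
  have hdiff : ∀ q ∈ s, ∀ (a b : W), ‖a - b‖ ≤ 2 * η →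
      ‖β (F μ q) a - β (F ν q) b‖ ≤ C * ‖F μ q - F ν q‖ * ‖a‖ + δ / 2 := by
    intro q hq a b hab
    have hsplit : β (F μ q) a - β (F ν q) b = β (F μ q - F ν q) a + β (F ν q) (a - b) := by
      have h1 : β (F μ q - F ν q) a = β (F μ q) a - β (F ν q) a := hβ.map_sub_left
      have h2 : β (F ν q) (a - b) = β (F ν q) a - β (F ν q) b := hβ.map_sub_right
      rw [h1, h2]; abel
    rw [hsplit]
    refine (norm_add_le _ _).trans (add_le_add (hC _ _) ((hC _ _).trans ?_))
    calc C * ‖F ν q‖ * ‖a - b‖ ≤ C * M * (2 * η) := by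
          gcongr
          exact hMν q hq
      _ = δ / 2 := by rw [hη]; field_simp; norm_num
  have h := norm_le_of_norm_fderiv_le hs (F := fun q => F μ q - F ν q)
    (fun q hq => (hFμ q hq).sub (hFν q hq)) (K := K') (ε := δ) (le_max_right _ _) hδ0.le
    (fun q hq w => by
      rw [planeForm_sub]
      refine (norm_planeForm_apply_le _ _ w).trans
        (mul_le_mul_of_nonneg_right ?_ (norm_nonneg w))
      have h1 := hdiff q hq _ _ (hclose e1μ e1ν q hq)
      have h2 := hdiff q hq _ _ (hclose e2μ e2ν q hq)
      have h3 : C * ‖F μ q - F ν q‖ * ‖A μ q‖ ≤ C * ‖F μ q - F ν q‖ * (K + 1) :=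
        mul_le_mul_of_nonneg_left (hAμ q hq) (by positivity)
      have h4 : C * ‖F μ q - F ν q‖ * ‖V μ q‖ ≤ C * ‖F μ q - F ν q‖ * (K + 1) :=
        mul_le_mul_of_nonneg_left (hVμ q hq) (by positivity)
      have h5 : 2 * C * (K + 1) * ‖F μ q - F ν q‖ ≤ K' * ‖F μ q - F ν q‖ :=
        mul_le_mul_of_nonneg_right (le_max_left _ _) (norm_nonneg _)
      linarith) hx hp (hdiam x hx p hp)
  refine hεU ?_
  have hxx : ‖F μ x - F ν x‖ < 2 * δ := by
    rw [← dist_eq_norm]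
    have := dist_triangle_right (F μ x) (F ν x) L
    linarith
  rw [dist_eq_norm]
  calc ‖F μ p - F ν p‖ ≤ (‖F μ x - F ν x‖ + δ) * Real.exp K' := h
    _ < (2 * δ + δ) * Real.exp K' := by gcongr
    _ = 3 / 4 * ε := by rw [hδ]; field_simp; norm_num
    _ < ε := by linarith

-- Packages the local situation around a point for both limit theorems: convergence at a single
-- point of a small ball forces uniform boundedness and the uniform Cauchy property on that ball.
include hβ in
theorem exists_ball_uniformCauchySeqOn (hO : IsOpen O) (hA₀ : ContinuousOn A₀ O)
    (hV₀ : ContinuousOn V₀ O) (hA : TendstoLocallyUniformlyOn A A₀ l O)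
    (hV : TendstoLocallyUniformlyOn V V₀ l O)
    (hF : ∀ᶠ μ in l, SolvesOn β (A μ) (V μ) (F μ) O) {c : ℝ × ℝ} (hc : c ∈ O) :
    ∃ r > 0, Metric.closedBall c r ⊆ O ∧ TendstoUniformlyOn A A₀ l (Metric.closedBall c r) ∧
      TendstoUniformlyOn V V₀ l (Metric.closedBall c r) ∧
      (∃ K, ∀ p ∈ Metric.closedBall c r, ‖A₀ p‖ ≤ K ∧ ‖V₀ p‖ ≤ K) ∧
      ∀ x ∈ Metric.closedBall c r, ∀ L, Tendsto (fun μ => F μ x) l (𝓝 L) →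
        (∃ M, ∀ᶠ μ in l, ∀ p ∈ Metric.closedBall c r, ‖F μ p‖ ≤ M) ∧
          UniformCauchySeqOn F l (Metric.closedBall c r) := by
  obtain ⟨r, hr, hr2, hsub⟩ := exists_closedBall_subset hO hc
  have hcp := isCompact_closedBall c r
  obtain ⟨K₁, hK₁⟩ := hcp.exists_bound_of_continuousOn (hA₀.mono hsub)
  obtain ⟨K₂, hK₂⟩ := hcp.exists_bound_of_continuousOn (hV₀.mono hsub)
  have hA' := (tendstoLocallyUniformlyOn_iff_tendstoUniformlyOn_of_compact hcp).1 (hA.mono hsub)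
  have hV' := (tendstoLocallyUniformlyOn_iff_tendstoUniformlyOn_of_compact hcp).1 (hV.mono hsub)
  refine ⟨r, hr, hsub, hA', hV', ⟨max K₁ K₂, fun p hp => ⟨(hK₁ p hp).trans (le_max_left _ _),
    (hK₂ p hp).trans (le_max_right _ _)⟩⟩, fun x hx L hL => ?_⟩
  exact uniformCauchySeqOn_of_family hβ (convex_closedBall c r)
    (fun a ha b hb => norm_sub_le_one_of_mem hr2 ha hb) (K := max K₁ K₂)
    (fun p hp => (hK₁ p hp).trans (le_max_left _ _))
    (fun p hp => (hK₂ p hp).trans (le_max_right _ _)) hA' hV'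
    (hF.mono fun μ hμ => hμ.mono hsub) hx hL

include hβ in
/-- Convergence of a family of solutions propagates from one point to a preconnected open set. -/
theorem exists_tendsto_of_family [CompleteSpace X] [l.NeBot] (hO : IsOpen O)
    (hconn : IsPreconnected O) (hA₀ : ContinuousOn A₀ O) (hV₀ : ContinuousOn V₀ O)
    (hA : TendstoLocallyUniformlyOn A A₀ l O) (hV : TendstoLocallyUniformlyOn V V₀ l O)
    (hF : ∀ᶠ μ in l, SolvesOn β (A μ) (V μ) (F μ) O) {x y : ℝ × ℝ} (hx : x ∈ O) (hy : y ∈ O)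
    (h : ∃ L, Tendsto (fun μ => F μ x) l (𝓝 L)) : ∃ L, Tendsto (fun μ => F μ y) l (𝓝 L) := by
  refine propagate_of_locally hconn (fun p => ∃ L, Tendsto (fun μ => F μ p) l (𝓝 L))
    (fun c hc => ?_) hx hy h
  obtain ⟨r, hr, -, -, -, -, hcau⟩ := exists_ball_uniformCauchySeqOn hβ hO hA₀ hV₀ hA hV hF hc
  refine ⟨_, Metric.closedBall_mem_nhds c hr, fun a ha b hb ⟨L, hL⟩ => ?_⟩
  exact cauchy_map_iff_exists_tendsto.1 ((hcau a ha L hL).2.cauchy_map hb)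

include hβ in
/-- The pointwise limit of a family of solutions solves the limit equation. -/
theorem SolvesOn.of_tendsto [l.NeBot] (hO : IsOpen O)
    (hA₀ : ContinuousOn A₀ O) (hV₀ : ContinuousOn V₀ O)
    (hA : TendstoLocallyUniformlyOn A A₀ l O) (hV : TendstoLocallyUniformlyOn V V₀ l O)
    (hF : ∀ᶠ μ in l, SolvesOn β (A μ) (V μ) (F μ) O) {F₀ : ℝ × ℝ → X}
    (hlim : ∀ p ∈ O, Tendsto (fun μ => F μ p) l (𝓝 (F₀ p))) : SolvesOn β A₀ V₀ F₀ O := by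
  intro c hc
  obtain ⟨C, hC0, hC⟩ := hβ.bound
  obtain ⟨r, hr, hsub, hA', hV', ⟨K, hK⟩, hcau⟩ :=
    exists_ball_uniformCauchySeqOn hβ hO hA₀ hV₀ hA hV hF hc
  obtain ⟨⟨M, hM⟩, hcau⟩ := hcau c (Metric.mem_closedBall_self hr.le) _ (hlim c hc)
  have hunif : TendstoUniformlyOn F F₀ l (Metric.closedBall c r) :=
    hcau.tendstoUniformlyOn_of_tendsto fun p hp => hlim p (hsub hp)
  have hball := Metric.closedBall_mem_nhds c hr
  refine hasFDerivAt_of_tendstoUniformlyOnFilter (l := l) (f := F)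
    (f' := fun μ p => planeForm (β (F μ p) (A μ p)) (β (F μ p) (V μ p)))
    (g' := fun p => planeForm (β (F₀ p) (A₀ p)) (β (F₀ p) (V₀ p))) ?_ ?_ ?_
  · refine (Metric.tendstoUniformlyOnFilter_iff (α := ℝ × ℝ →L[ℝ] X)).2 fun ε hε => ?_
    -- Makes the error of each partial derivative at most ε/4; the maxima with 0 and the summand 1
    -- only keep the denominator positive.
    set δ := ε / (4 * C * (max K 0 + max M 0 + 1)) with hδ
    have hKM : 0 < max K 0 + max M 0 + 1 :=
      add_pos_of_nonneg_of_pos (add_nonneg (le_max_right _ _) (le_max_right _ _)) one_pos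
    have hδ0 : 0 < δ := by positivity
    have hall := (hM.and (Metric.tendstoUniformlyOn_iff.1 hunif δ hδ0)).and
      ((Metric.tendstoUniformlyOn_iff.1 hA' δ hδ0).and (Metric.tendstoUniformlyOn_iff.1 hV' δ hδ0))
    filter_upwards [hall.prod_mk hball] with q hq
    obtain ⟨⟨⟨hMq, h1⟩, h2, h3⟩, hqb⟩ := hq
    obtain ⟨μ, p⟩ := q
    have hdiff : ∀ a b : W, ‖a‖ ≤ K → dist a b < δ → ‖β (F₀ p) a - β (F μ p) b‖ ≤ ε / 4 := by
      intro a b ha hab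
      have hsplit : β (F₀ p) a - β (F μ p) b = β (F₀ p - F μ p) a + β (F μ p) (a - b) := by
        have h1 : β (F₀ p - F μ p) a = β (F₀ p) a - β (F μ p) a := hβ.map_sub_left
        have h2 : β (F μ p) (a - b) = β (F μ p) a - β (F μ p) b := hβ.map_sub_right
        rw [h1, h2]; abel
      have hF1 : ‖F₀ p - F μ p‖ ≤ δ := by rw [← dist_eq_norm]; exact (h1 p hqb).le
      have hF2 : ‖F μ p‖ ≤ max M 0 := (hMq p hqb).trans (le_max_left _ _)
      have hW1 : ‖a - b‖ ≤ δ := by rw [← dist_eq_norm]; exact hab.le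
      have hW2 : ‖a‖ ≤ max K 0 := ha.trans (le_max_left _ _)
      rw [hsplit]
      calc ‖β (F₀ p - F μ p) a + β (F μ p) (a - b)‖
          ≤ C * ‖F₀ p - F μ p‖ * ‖a‖ + C * ‖F μ p‖ * ‖a - b‖ :=
            (norm_add_le _ _).trans (add_le_add (hC _ _) (hC _ _))
        _ ≤ C * δ * max K 0 + C * max M 0 * δ := by gcongr
        _ ≤ C * δ * (max K 0 + max M 0 + 1) := by nlinarith [mul_pos hC0 hδ0]
        _ = ε / 4 := by rw [hδ]; field_simp
    have hd1 := hdiff _ _ (hK p hqb).1 (h2 p hqb)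
    have hd2 := hdiff _ _ (hK p hqb).2 (h3 p hqb)
    rw [dist_eq_norm, planeForm_sub]
    refine lt_of_le_of_lt (ContinuousLinearMap.opNorm_le_bound _ (by positivity)
      (norm_planeForm_apply_le _ _)) ?_
    linarith
  · filter_upwards [hF.prod_mk (hO.mem_nhds hc)] with q hq
    exact hq.1 q.2 hq.2
  · filter_upwards [hO.mem_nhds hc] with p hp
    exact hlim p hp

end TotalODE

/-! ### Linear systems F_x = FA, F_t = FV depending on a parameter -/

section LinearSystem

open Filter Topology

theorem tendstoLocallyUniformlyOn_of_continuousOn {P Z W : Type*} [TopologicalSpace P]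
    [TopologicalSpace Z] [PseudoMetricSpace W] {O : Set P} (hO : IsOpen O) {G : Z → P → W}
    (hG : ContinuousOn (fun q : Z × P => G q.1 q.2) (Set.univ ×ˢ O)) (z₀ : Z) {l : Filter Z}
    (hl : l ≤ 𝓝 z₀) : TendstoLocallyUniformlyOn G (G z₀) l O := by
  rw [tendstoLocallyUniformlyOn_iff_filter]
  intro p hp
  rw [hO.nhdsWithin_eq hp, Metric.tendstoUniformlyOnFilter_iff]
  intro ε hε
  have h1 : ContinuousAt (fun q : Z × P => G q.1 q.2) (z₀, p) :=
    hG.continuousAt ((isOpen_univ.prod hO).mem_nhds ⟨trivial, hp⟩)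
  have h2 : ContinuousAt (fun q : Z × P => G z₀ q.2) (z₀, p) :=
    ContinuousAt.comp (x := (z₀, p)) (f := fun q : Z × P => (z₀, q.2)) h1
      (continuousAt_const.prodMk continuousAt_snd)
  have h3 : Tendsto (fun q : Z × P => dist (G z₀ q.2) (G q.1 q.2)) (𝓝 (z₀, p)) (𝓝 0) := by
    have := h2.tendsto.dist h1.tendsto
    simpa using this
  have h4 := h3.eventually_lt_const hε
  rw [nhds_prod_eq] at h4
  exact h4.filter_mono (Filter.prod_mono hl le_rfl)

variable {R : Type*} [NormedRing R] [NormedAlgebra ℝ R]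

theorem isBoundedBilinearMap_ringMul :
    IsBoundedBilinearMap ℝ fun p : R × R => (fun x w : R => x * w) p.1 p.2 :=
  (ContinuousLinearMap.mul ℝ R).isBoundedBilinearMap

/-- `F` solves `F_x = F A`, `F_t = F V` on `s`. -/
abbrev RightSolvesOn (A V : ℝ × ℝ → R) (F : ℝ × ℝ → R) (s : Set (ℝ × ℝ)) : Prop :=
  SolvesOn (fun x w : R => x * w) A V F s

theorem planeForm_eta {X : Type*} [NormedAddCommGroup X] [NormedSpace ℝ X]
    (f : ℝ × ℝ →L[ℝ] X) : planeForm (f (1, 0)) (f (0, 1)) = f := by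
  ext <;> simp [planeForm_apply]

theorem rightSolvesOn_iff_fderiv {A V F : ℝ × ℝ → R} {O : Set (ℝ × ℝ)}
    (hF : ∀ p ∈ O, HasFDerivAt F (fderiv ℝ F p) p) : RightSolvesOn A V F O ↔
      ∀ p ∈ O, fderiv ℝ F p (1, 0) = F p * A p ∧ fderiv ℝ F p (0, 1) = F p * V p := by
  constructor
  · intro h p hp
    rw [(h p hp).fderiv]
    simp [planeForm_apply]
  · intro h p hp
    refine (hF p hp).congr_fderiv ?_
    simp only [← (h p hp).1, ← (h p hp).2, planeForm_eta]

theorem RightSolvesOn.sub {A V F G : ℝ × ℝ → R} {s : Set (ℝ × ℝ)} (hF : RightSolvesOn A V F s)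
    (hG : RightSolvesOn A V G s) : RightSolvesOn A V (fun p => F p - G p) s := fun p hp => by
  refine ((hF p hp).sub (hG p hp)).congr_fderiv ?_
  simp only [planeForm_sub, sub_mul]

theorem rightSolvesOn_zero (A V : ℝ × ℝ → R) (s : Set (ℝ × ℝ)) :
    RightSolvesOn A V (fun _ => 0) s := fun p _ => by
  refine (hasFDerivAt_const 0 p).congr_fderiv ?_
  ext <;> simp [planeForm_apply]

theorem RightSolvesOn.conj {A V F : ℝ × ℝ → R} {s : Set (ℝ × ℝ)} (hF : RightSolvesOn A V F s)
    {C D D' : R} (hD : D * D' = 1) :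
    RightSolvesOn (fun p => D' * A p * D) (fun p => D' * V p * D) (fun p => C * F p * D) s :=
  fun p hp => by
    have h : ∀ x : R, C * F p * D * (D' * x * D) = C * (F p * x) * D := fun x => by
      calc C * F p * D * (D' * x * D) = C * F p * (D * D') * x * D := by noncomm_ring
        _ = _ := by rw [hD]; noncomm_ring
    refine (((hF p hp).const_mul C).mul_const' D).congr_fderiv ?_
    simp only [h]
    ext <;> simp [planeForm_apply]

/-- Bootstrap: the derivative of F is bilinear in F and the smooth coefficients, so each order of
regularity yields the next. -/
theorem RightSolvesOn.contDiffOn {A V F : ℝ × ℝ → R} {O : Set (ℝ × ℝ)} (hO : IsOpen O)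
    (hA : ContDiffOn ℝ ∞ A O) (hV : ContDiffOn ℝ ∞ V O) (hF : RightSolvesOn A V F O) :
    ContDiffOn ℝ ∞ F O := by
  rw [contDiffOn_infty]
  intro m
  induction m with
  | zero =>
    rw [Nat.cast_zero, contDiffOn_zero]
    exact fun p hp => (hF p hp).continuousAt.continuousWithinAt
  | succ m ih =>
    rw [Nat.cast_succ, contDiffOn_succ_iff_fderiv_of_isOpen hO]
    refine ⟨fun p hp => (hF p hp).differentiableAt.differentiableWithinAt, by simp, ?_⟩
    refine ContDiffOn.congr ?_ fun p hp => (hF p hp).fderiv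
    rw [contDiffOn_clm_apply]
    intro w
    simp only [planeForm_apply]
    have hA' : ContDiffOn ℝ m A O := contDiffOn_infty.1 hA m
    have hV' : ContDiffOn ℝ m V O := contDiffOn_infty.1 hV m
    exact ((ih.mul hA').const_smul w.1).add ((ih.mul hV').const_smul w.2)

/-- The pairing `((e, δ), (a, s, b)) ↦ (e a, e s + δ b)` governing difference quotients. -/
def quotientPairing (x : R × R) (w : R × R × R) : R × R :=
  (x.1 * w.1, x.1 * w.2.1 + x.2 * w.2.2)

theorem isBoundedBilinearMap_quotientPairing :
    IsBoundedBilinearMap ℝ fun p : (R × R) × (R × R × R) => quotientPairing p.1 p.2 where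
  add_left x x' w := by
    ext <;> simp only [quotientPairing, Prod.fst_add, Prod.snd_add, add_mul]
    abel
  smul_left c x w := by
    ext <;> simp [quotientPairing]
  add_right x w w' := by
    ext <;> simp only [quotientPairing, Prod.fst_add, Prod.snd_add, mul_add]
    abel
  smul_right c x w := by
    ext <;> simp [quotientPairing]
  bound := by
    refine ⟨2, two_pos, fun x w => ?_⟩
    have hx1 : ‖x.1‖ ≤ ‖x‖ := norm_fst_le x
    have hx2 : ‖x.2‖ ≤ ‖x‖ := norm_snd_le x
    have hw1 : ‖w.1‖ ≤ ‖w‖ := norm_fst_le w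
    have hw : ‖w.2‖ ≤ ‖w‖ := norm_snd_le w
    have hw2 : ‖w.2.1‖ ≤ ‖w‖ := (norm_fst_le w.2).trans hw
    have hw3 : ‖w.2.2‖ ≤ ‖w‖ := (norm_snd_le w.2).trans hw
    have h1 : ‖x.1 * w.1‖ ≤ ‖x‖ * ‖w‖ := (norm_mul_le _ _).trans (by gcongr)
    have h2 : ‖x.1 * w.2.1‖ ≤ ‖x‖ * ‖w‖ := (norm_mul_le _ _).trans (by gcongr)
    have h3 : ‖x.2 * w.2.2‖ ≤ ‖x‖ * ‖w‖ := (norm_mul_le _ _).trans (by gcongr)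
    have h4 := norm_add_le (x.1 * w.2.1) (x.2 * w.2.2)
    have h5 : 0 ≤ ‖x‖ * ‖w‖ := by positivity
    rw [quotientPairing, Prod.norm_mk]
    exact max_le (by linarith) (by linarith)

/-- Solutions of a linear system depend holomorphically on a parameter on which the coefficients
depend holomorphically. -/
theorem differentiableAt_parameter [NormedAlgebra ℂ R] [SMulCommClass ℝ ℂ R] [CompleteSpace R]
    {O : Set (ℝ × ℝ)} (hO : IsOpen O) (hconn : IsPreconnected O) {A V SA SV : ℂ → ℝ × ℝ → R}
    {E : ℝ × ℝ → ℂ → R} (hE : ∀ z, RightSolvesOn (A z) (V z) (fun p => E p z) O) (z₀ : ℂ)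
    (hA : ContinuousOn (fun q : ℂ × (ℝ × ℝ) => A q.1 q.2) (Set.univ ×ˢ O))
    (hV : ContinuousOn (fun q : ℂ × (ℝ × ℝ) => V q.1 q.2) (Set.univ ×ˢ O))
    (hSA : ContinuousOn (fun q : ℂ × (ℝ × ℝ) => SA q.1 q.2) (Set.univ ×ˢ O))
    (hSV : ContinuousOn (fun q : ℂ × (ℝ × ℝ) => SV q.1 q.2) (Set.univ ×ˢ O))
    (hAS : ∀ z p, A z p - A z₀ p = (z - z₀) • SA z p)
    (hVS : ∀ z p, V z p - V z₀ p = (z - z₀) • SV z p)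
    {x y : ℝ × ℝ} (hx : x ∈ O) (hy : y ∈ O) (h0 : DifferentiableAt ℂ (E x) z₀) :
    DifferentiableAt ℂ (E y) z₀ := by
  let _ : NormedSpace ℝ R := NormedAlgebra.toNormedSpace R
  have hslice : ∀ {G : ℂ → ℝ × ℝ → R},
      ContinuousOn (fun q : ℂ × (ℝ × ℝ) => G q.1 q.2) (Set.univ ×ˢ O) →
      ContinuousOn (fun q : ℂ × (ℝ × ℝ) => G z₀ q.2) (Set.univ ×ˢ O) := fun hG =>
    hG.comp (f := fun q : ℂ × (ℝ × ℝ) => (z₀, q.2)) (by fun_prop)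
      fun q hq => ⟨trivial, hq.2⟩
  have hslice' : ∀ {G : ℂ → ℝ × ℝ → R × R × R},
      ContinuousOn (fun q : ℂ × (ℝ × ℝ) => G q.1 q.2) (Set.univ ×ˢ O) →
      ContinuousOn (G z₀) O := fun hG =>
    hG.comp (f := fun p : ℝ × ℝ => (z₀, p)) (by fun_prop) fun q hq => ⟨trivial, hq⟩
  have cA : ContinuousOn (fun q : ℂ × (ℝ × ℝ) => (A z₀ q.2, SA q.1 q.2, A q.1 q.2))
      (Set.univ ×ˢ O) := (hslice hA).prodMk (hSA.prodMk hA)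
  have cV : ContinuousOn (fun q : ℂ × (ℝ × ℝ) => (V z₀ q.2, SV q.1 q.2, V q.1 q.2))
      (Set.univ ×ˢ O) := (hslice hV).prodMk (hSV.prodMk hV)
  -- The difference quotient Δ of E satisfies Δ_x = E(z₀) S + Δ A(z), with S the quotient of A. The
  -- pair (E(z₀), Δ) thus solves a linear system whose coefficients extend continuously to z = z₀,
  -- and convergence of Δ propagates from x to y.
  have hquot : ∀ z, z ≠ z₀ → ∀ e e' a a' s : R, a' - a = (z - z₀) • s →
      (z - z₀)⁻¹ • (e' * a' - e * a) = e * s + ((z - z₀)⁻¹ • (e' - e)) * a' := by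
    intro z hz e e' a a' s h
    have h1 : e' * a' - e * a = e * (a' - a) + (e' - e) * a' := by noncomm_ring
    rw [h1, h, smul_add, mul_smul_comm, smul_smul, inv_mul_cancel₀ (sub_ne_zero.2 hz), one_smul,
      smul_mul_assoc]
  have key := exists_tendsto_of_family (β := quotientPairing)
    (isBoundedBilinearMap_quotientPairing (R := R)) hO hconn
    (l := 𝓝[≠] z₀) (A := fun z p => (A z₀ p, SA z p, A z p))
    (V := fun z p => (V z₀ p, SV z p, V z p))
    (F := fun z p => (E p z₀, slope (E p) z₀ z))
    (hslice' cA) (hslice' cV)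
    (tendstoLocallyUniformlyOn_of_continuousOn hO cA z₀ nhdsWithin_le_nhds)
    (tendstoLocallyUniformlyOn_of_continuousOn hO cV z₀ nhdsWithin_le_nhds) ?_ hx hy ?_
  · obtain ⟨L, hL⟩ := key
    exact (hasDerivAt_iff_tendsto_slope.2 ((continuous_snd.tendsto L).comp hL)).differentiableAt
  · filter_upwards [self_mem_nhdsWithin] with z hz p hp
    have h1 := (((hE z p hp).sub (hE z₀ p hp)).const_smul (z - z₀)⁻¹)
    refine ((hE z₀ p hp).prodMk h1).congr_fderiv ?_
    have hxx := hquot z hz (E p z₀) (E p z) _ _ _ (hAS z p)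
    have hyy := hquot z hz (E p z₀) (E p z) _ _ _ (hVS z p)
    rw [planeForm_sub]
    ext
    · simp [planeForm_apply, quotientPairing]
    · simp [planeForm_apply, quotientPairing, slope_def_module, hxx]
    · simp [planeForm_apply, quotientPairing]
    · simp [planeForm_apply, quotientPairing, slope_def_module, hyy]
  · exact ⟨(E x z₀, deriv (E x) z₀), tendsto_const_nhds.prodMk_nhds
      (hasDerivAt_iff_tendsto_slope.1 h0.hasDerivAt)⟩

/-- Solutions for generic values of a parameter, continuous in the parameter, are solutions. -/
theorem RightSolvesOn.of_punctured {O : Set (ℝ × ℝ)} (hO : IsOpen O) {A V : ℂ → ℝ × ℝ → R}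
    {E : ℝ × ℝ → ℂ → R} (z₀ : ℂ)
    (hE : ∀ᶠ z in 𝓝[≠] z₀, RightSolvesOn (A z) (V z) (fun p => E p z) O)
    (hA : ContinuousOn (fun q : ℂ × (ℝ × ℝ) => A q.1 q.2) (Set.univ ×ˢ O))
    (hV : ContinuousOn (fun q : ℂ × (ℝ × ℝ) => V q.1 q.2) (Set.univ ×ˢ O))
    (hc : ∀ p ∈ O, ContinuousAt (E p) z₀) :
    RightSolvesOn (A z₀) (V z₀) (fun p => E p z₀) O := by
  have hslice : ∀ {G : ℂ → ℝ × ℝ → R},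
      ContinuousOn (fun q : ℂ × (ℝ × ℝ) => G q.1 q.2) (Set.univ ×ˢ O) →
      ContinuousOn (G z₀) O := fun hG =>
    hG.comp (f := fun p : ℝ × ℝ => (z₀, p)) (by fun_prop) fun q hq => ⟨trivial, hq⟩
  exact SolvesOn.of_tendsto isBoundedBilinearMap_ringMul hO (hslice hA) (hslice hV)
    (tendstoLocallyUniformlyOn_of_continuousOn hO hA z₀ nhdsWithin_le_nhds)
    (tendstoLocallyUniformlyOn_of_continuousOn hO hV z₀ nhdsWithin_le_nhds) (F := fun z p => E p z)
    hE fun p hp => (hc p hp).tendsto.mono_left nhdsWithin_le_nhds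

end LinearSystem

/-! ### The Lax system of a trivialization: invertibility, holomorphy, symmetry -/

section Lax

attribute [local instance] Matrix.linftyOpNormedRing Matrix.linftyOpNormedAlgebra

open Filter Topology

variable {n : ℕ} {O : Set (ℝ × ℝ)} {u : ℝ × ℝ → Mat n}

/-- The coefficient of the `x`-equation of the linear system. -/
noncomputable def laxA (u : ℝ × ℝ → Mat n) (z : ℂ) (p : ℝ × ℝ) : Mat n := z • aMat n + u p

/-- The coefficient of the `t`-equation of the linear system. -/
noncomputable def laxV (u : ℝ × ℝ → Mat n) (z : ℂ) (p : ℝ × ℝ) : Mat n :=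
  ∑ j ∈ Finset.range (n + 2), z ^ (n + 1 - j) • Q u j p

theorem contDiffOn_laxA (hu : ContDiffOn ℝ ∞ u O) (z : ℂ) : ContDiffOn ℝ ∞ (laxA u z) O :=
  contDiffOn_const.add hu

theorem contDiffOn_laxV (hO : IsOpen O) (hu : ContDiffOn ℝ ∞ u O) (z : ℂ) :
    ContDiffOn ℝ ∞ (laxV u z) O :=
  ContDiffOn.sum fun j _ => (contDiffOn_Q hO hu j).const_smul (z ^ (n + 1 - j))

theorem continuousOn_snd {f : ℝ × ℝ → Mat n} (hf : ContDiffOn ℝ ∞ f O) :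
    ContinuousOn (fun q : ℂ × (ℝ × ℝ) => f q.2) (Set.univ ×ˢ O) :=
  hf.continuousOn.comp continuous_snd.continuousOn fun _ hq => hq.2

theorem continuousOn_laxA (hu : ContDiffOn ℝ ∞ u O) :
    ContinuousOn (fun q : ℂ × (ℝ × ℝ) => laxA u q.1 q.2) (Set.univ ×ˢ O) :=
  (continuous_fst.smul continuous_const).continuousOn.add (continuousOn_snd hu)

theorem continuousOn_laxV (hO : IsOpen O) (hu : ContDiffOn ℝ ∞ u O) :
    ContinuousOn (fun q : ℂ × (ℝ × ℝ) => laxV u q.1 q.2) (Set.univ ×ˢ O) :=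
  continuousOn_finsetSum _ fun j _ =>
    (continuous_fst.pow _).continuousOn.smul (continuousOn_snd (contDiffOn_Q hO hu j))

theorem rightSolvesOn_iff {f A V : ℝ × ℝ → Mat n} (hO : IsOpen O) (hf : ContDiffOn ℝ ∞ f O) :
    RightSolvesOn A V f O ↔ ∀ p ∈ O, dx f p = f p * A p ∧ dt f p = f p * V p := by
  rw [rightSolvesOn_iff_fderiv fun p hp => hasFDerivAt_of_contDiffOn hO hf hp]
  refine forall₂_congr fun p hp => ?_
  rw [dx_eq_fderiv hO hf hp, dt_eq_fderiv hO hf hp]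
  exact Iff.rfl

theorem IsTrivialization.rightSolvesOn {E : ℝ × ℝ → ℂ → Mat n} (hO : IsOpen O)
    (hE : IsTrivialization n O u E) (z : ℂ) :
    RightSolvesOn (laxA u z) (laxV u z) (fun p => E p z) O :=
  (rightSolvesOn_iff hO (hE.smooth z)).2 fun p hp => ⟨hE.eqn_x z p hp, hE.eqn_t z p hp⟩

theorem RightSolvesOn.eq_of_eq {A V F G : ℝ × ℝ → Mat n} (hO : IsOpen O)
    (hc : IsPreconnected O) (hA : ContDiffOn ℝ ∞ A O) (hV : ContDiffOn ℝ ∞ V O)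
    (hF : RightSolvesOn A V F O) (hG : RightSolvesOn A V G O) {x y : ℝ × ℝ}
    (hx : x ∈ O) (hy : y ∈ O) (h0 : F x = G x) : F y = G y := by
  exact sub_eq_zero.1 (SolvesOn.eq_zero isBoundedBilinearMap_ringMul hO hc hA.continuousOn
    hV.continuousOn (hF.sub hG) hx hy (sub_eq_zero.2 h0))

/-- A row vector c with c E(p, z) = 0 gives a solution of the same linear system that vanishes at p,
hence also at the origin, where E = 1; so c = 0. -/
theorem isUnit_det_of_trivialization [NeZero n] {E : ℝ × ℝ → ℂ → Mat n} (hO : IsOpen O)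
    (hc : IsPreconnected O) (h0 : (0, 0) ∈ O) (hu : ContDiffOn ℝ ∞ u O)
    (hE : IsTrivialization n O u E) {p : ℝ × ℝ} (hp : p ∈ O) (z : ℂ) : IsUnit (E p z).det := by
  rw [isUnit_iff_ne_zero]
  intro hdet
  obtain ⟨c, hc0, hcE⟩ := Matrix.exists_vecMul_eq_zero_iff.2 hdet
  -- Repeating the row c makes the solution square, so that uniqueness for matrix systems applies.
  set D : Mat n := Matrix.of fun _ => c with hD
  have hDmul : ∀ G : Mat n, D * G = Matrix.of fun _ => c ᵥ* G := fun G => by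
    ext i j; rfl
  have hs : RightSolvesOn (laxA u z) (laxV u z) (fun q => D * E q z) O := by
    simpa using (hE.rightSolvesOn hO z).conj (C := D) (mul_one (1 : Mat n))
  have h := RightSolvesOn.eq_of_eq hO hc (contDiffOn_laxA hu z) (contDiffOn_laxV hO hu z) hs
    (rightSolvesOn_zero _ _ O) hp h0 (by rw [hDmul, hcE]; rfl)
  rw [hE.normalized, Matrix.mul_one] at h
  exact hc0 (congrFun h 0)

/-- At the origin E is constant in λ; holomorphy spreads from there because the Lax coefficients are
polynomial in λ. -/
theorem differentiable_of_trivialization {E : ℝ × ℝ → ℂ → Mat n} (hO : IsOpen O)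
    (hc : IsPreconnected O) (h0 : (0, 0) ∈ O) (hu : ContDiffOn ℝ ∞ u O)
    (hE : IsTrivialization n O u E) {p : ℝ × ℝ} (hp : p ∈ O) : Differentiable ℂ (E p) := by
  intro z₀
  refine differentiableAt_parameter (R := Mat n) hO hc (A := laxA u) (V := laxV u)
    (SA := fun _ _ => aMat n)
    (SV := fun z q => ∑ j ∈ Finset.range (n + 2),
      dslope (fun w : ℂ => w ^ (n + 1 - j)) z₀ z • Q u j q)
    (hE.rightSolvesOn hO) z₀ (continuousOn_laxA hu) (continuousOn_laxV hO hu) continuousOn_const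
    ?_ ?_ ?_ h0 hp ?_
  · refine continuousOn_finsetSum _ fun j _ => ContinuousOn.fun_smul ?_
      (continuousOn_snd (contDiffOn_Q hO hu j))
    have hd : Differentiable ℂ (dslope (fun w : ℂ => w ^ (n + 1 - j)) z₀) := by
      rw [← differentiableOn_univ, Complex.differentiableOn_dslope univ_mem]
      exact (differentiable_pow _).differentiableOn
    exact (hd.continuous.comp continuous_fst).continuousOn
  · intro z q
    rw [laxA, laxA, add_sub_add_right_eq_sub, sub_smul]
  · intro z q
    rw [laxV, laxV, ← Finset.sum_sub_distrib, Finset.smul_sum]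
    refine Finset.sum_congr rfl fun j _ => ?_
    rw [smul_smul, ← smul_eq_mul, sub_smul_dslope, sub_smul]
  · have : E (0, 0) = fun _ => 1 := funext hE.normalized
    rw [this]
    exact differentiableAt_const _

theorem tauConj_laxV [NeZero n] (hO : IsOpen O) (hu : ContDiffOn ℝ ∞ u O)
    (hτ : ∀ p ∈ O, tauConj n (u p) = u p) {p : ℝ × ℝ} (hp : p ∈ O) {j : ℕ} (hj : j ≤ n + 1) :
    tauConj n (Q u j p) = root n ^ (n + 1 - j) • Q u j p := by
  have h := tauConj_Q hO hu hτ j hp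
  -- The flow number enters here: n + 1 ≡ 1 mod n, so the weight α^{1-j} of Q_{a,j} matches the
  -- power of λ that multiplies it.
  have hr : root n ^ (n + 1 - j) * root n ^ j = root n := by
    rw [← pow_add, Nat.sub_add_cancel hj, pow_succ, root_pow_self, one_mul]
  refine smul_right_injective _ (pow_ne_zero j (root_ne_zero (n := n))) ?_
  simp only
  rw [h, smul_smul, mul_comm, hr]

/-- Replacing λ by αλ in the Lax coefficients conjugates them by τ, so both sides solve the same
system with the same initial value. -/
theorem trivialization_root_mul [NeZero n] {E : ℝ × ℝ → ℂ → Mat n} (hO : IsOpen O)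
    (hc : IsPreconnected O) (h0 : (0, 0) ∈ O) (hu : ContDiffOn ℝ ∞ u O)
    (hτ : ∀ p ∈ O, tauConj n (u p) = u p)
    (hE : IsTrivialization n O u E) {p : ℝ × ℝ} (hp : p ∈ O) (z : ℂ) :
    E p (root n * z) = tauConj n (E p z) := by
  have hs : RightSolvesOn (laxA u (root n * z)) (laxV u (root n * z))
      (fun q => tauConj n (E q z)) O := fun q hq => by
    have h1 := (hE.rightSolvesOn hO z).conj (C := (tau n)⁻¹)
      (Matrix.mul_nonsing_inv _ (isUnit_det_tau (n := n))) q hq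
    have hA : laxA u (root n * z) q = tauConj n (laxA u z q) := by
      rw [laxA, laxA, map_add, hτ q hq, tauConj_smul, tauConj_aMat, smul_smul, mul_comm]
    have hV : laxV u (root n * z) q = tauConj n (laxV u z q) := by
      rw [laxV, laxV, map_sum]
      refine Finset.sum_congr rfl fun j hj => ?_
      rw [tauConj_smul, tauConj_laxV hO hu hτ hq (Nat.lt_succ_iff.1 (Finset.mem_range.1 hj)),
        smul_smul, mul_pow, mul_comm]
    rw [hA, hV]
    exact h1
  exact RightSolvesOn.eq_of_eq hO hc (contDiffOn_laxA hu _) (contDiffOn_laxV hO hu _)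
    (hE.rightSolvesOn hO (root n * z)) hs h0 hp (by simp only [hE.normalized, map_one])

theorem trivialization_root_pow_mul [NeZero n] {E : ℝ × ℝ → ℂ → Mat n} (hO : IsOpen O)
    (hc : IsPreconnected O) (h0 : (0, 0) ∈ O) (hu : ContDiffOn ℝ ∞ u O)
    (hτ : ∀ p ∈ O, tauConj n (u p) = u p)
    (hE : IsTrivialization n O u E) {p : ℝ × ℝ} (hp : p ∈ O) (z : ℂ) (j : ℕ) :
    E p (root n ^ j * z) * (tau n)⁻¹ ^ j = (tau n)⁻¹ ^ j * E p z := by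
  induction j with
  | zero => simp
  | succ j ih =>
    rw [pow_succ', mul_assoc, trivialization_root_mul hO hc h0 hu hτ hE hp, tauConj_apply,
      pow_succ' (tau n)⁻¹, Matrix.mul_assoc, ← Matrix.mul_assoc (tau n),
      Matrix.mul_nonsing_inv _ isUnit_det_tau, Matrix.one_mul, Matrix.mul_assoc, ih,
      Matrix.mul_assoc]

end Lax

/-! ### Evolution of k B(w) a B(w)⁻¹ -/

section Evolution

attribute [local instance] Matrix.linftyOpNormedRing Matrix.linftyOpNormedAlgebra

variable {n : ℕ}

theorem hasDerivAt_mat_inv {f : ℝ → Mat n} {f' : Mat n} {s : ℝ} (hf : HasDerivAt f f' s)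
    (h : IsUnit (f s).det) : HasDerivAt (fun t => (f t)⁻¹) (-((f s)⁻¹ * f' * (f s)⁻¹)) s := by
  obtain ⟨U, hU⟩ := (Matrix.isUnit_iff_isUnit_det _).2 h
  have h1 := hasFDerivAt_ringInverse (𝕜 := ℝ) U
  rw [hU] at h1
  have hUinv : ((U⁻¹ : (Mat n)ˣ) : Mat n) = (f s)⁻¹ := by
    rw [← hU, Matrix.coe_units_inv]
  have h2 := h1.comp_hasDerivAt s hf
  simp only [Matrix.nonsing_inv_eq_ringInverse] at hUinv ⊢
  rw [← hUinv]
  exact h2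

theorem contDiffOn_mat_inv {P : Type*} [NormedAddCommGroup P] [NormedSpace ℝ P] {s : Set P}
    {f : P → Mat n} (hf : ContDiffOn ℝ ∞ f s) (h : ∀ p ∈ s, IsUnit (f p).det) :
    ContDiffOn ℝ ∞ (fun p => (f p)⁻¹) s := by
  intro p hp
  obtain ⟨U, hU⟩ := (Matrix.isUnit_iff_isUnit_det _).2 (h p hp)
  have h1 := contDiffAt_ringInverse (n := ∞) ℝ U
  rw [hU] at h1
  simp only [Matrix.nonsing_inv_eq_ringInverse]
  exact h1.comp_contDiffWithinAt p (hf p hp)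

theorem hasDerivAt_B_mulVec [NeZero n] {f : ℝ → Mat n} {f' : Mat n} {s : ℝ}
    (hf : HasDerivAt f f' s) (v : Fin n → ℂ) :
    HasDerivAt (fun t => B (f t *ᵥ v)) (B (f' *ᵥ v)) s := by
  rw [hasDerivAt_mat_iff] at hf ⊢
  intro i j
  simp only [B_apply, Matrix.mulVec, dotProduct]
  exact HasDerivAt.fun_sum fun l _ => (hf (i + j) l).mul_const (v l)

theorem contDiffOn_B_mulVec [NeZero n] {P : Type*} [NormedAddCommGroup P] [NormedSpace ℝ P]
    {s : Set P} {f : P → Mat n} (hf : ContDiffOn ℝ ∞ f s) (v : Fin n → ℂ) :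
    ContDiffOn ℝ ∞ (fun p => B (f p *ᵥ v)) s := by
  rw [contDiffOn_mat_iff] at hf ⊢
  intro i j
  simp only [B_apply, Matrix.mulVec, dotProduct]
  exact ContDiffOn.sum fun l _ => (hf (i + j) l).mul contDiffOn_const

/-- The matrix `k B(w) a B(w)⁻¹`, whose eigenvalue on the line of `τ^{-j} w` is `k α ^ j`. -/
noncomputable def poleMat (w : Fin n → ℂ) (k : ℂ) : Mat n := k • (B w * aMat n * (B w)⁻¹)

theorem Ymat_eq (w : Fin n → ℂ) (k : ℂ) : Ymat w k = -(aMat n * poleMat w k) := by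
  rw [Ymat, poleMat, Matrix.mul_smul, ← Matrix.mul_assoc, ← Matrix.mul_assoc]

theorem poleMat_mul_B {w : Fin n → ℂ} (k : ℂ) (hw : IsUnit (B w).det) :
    poleMat w k * B w = k • (B w * aMat n) := by
  rw [poleMat, Matrix.smul_mul, Matrix.mul_assoc, Matrix.nonsing_inv_mul _ hw, Matrix.mul_one]

theorem poleMat_pow_mul_B {w : Fin n → ℂ} (k : ℂ) (hw : IsUnit (B w).det) (e : ℕ) :
    poleMat w k ^ e * B w = k ^ e • (B w * aMat n ^ e) := by
  induction e with
  | zero => simp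
  | succ e ih =>
    rw [pow_succ, Matrix.mul_assoc, poleMat_mul_B k hw, Matrix.mul_smul, ← Matrix.mul_assoc, ih,
      Matrix.smul_mul, smul_smul, pow_succ, pow_succ, Matrix.mul_assoc, mul_comm k]

theorem tauConj_poleMat [NeZero n] {w : Fin n → ℂ} (k : ℂ) (hw : IsUnit (B w).det) :
    root n • tauConj n (poleMat w k) = poleMat w k := by
  have hτ := Matrix.mul_nonsing_inv _ (isUnit_det_tau (n := n))
  have h1 : tau n * B w = B w * (tau n)⁻¹ := by
    calc tau n * B w = tau n * (B w * tau n) * (tau n)⁻¹ := by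
          rw [Matrix.mul_assoc, Matrix.mul_assoc, hτ, Matrix.mul_one]
      _ = B w * (tau n)⁻¹ := by
          rw [← tau_inv_mul_B, ← Matrix.mul_assoc, hτ, Matrix.one_mul]
  have h2 : root n • (tau n * aMat n * (tau n)⁻¹) = aMat n := by
    rw [← Matrix.smul_mul, ← aMat_mul_tau, Matrix.mul_assoc, hτ, Matrix.mul_one]
  have h3 : root n • tauConj n (poleMat w k) * B w = poleMat w k * B w := by
    calc root n • tauConj n (poleMat w k) * B w
        = root n • ((tau n)⁻¹ * (poleMat w k * B w) * (tau n)⁻¹) := by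
          rw [tauConj_apply, Matrix.smul_mul, Matrix.mul_assoc _ (tau n), h1]
          simp only [Matrix.mul_assoc]
      _ = k • (B w * root n • (tau n * aMat n * (tau n)⁻¹)) := by
          rw [poleMat_mul_B k hw, Matrix.mul_smul, ← Matrix.mul_assoc, tau_inv_mul_B]
          simp only [Matrix.mul_assoc, Matrix.smul_mul, Matrix.mul_smul]
          rw [smul_comm]
      _ = poleMat w k * B w := by rw [h2, poleMat_mul_B k hw]
  calc root n • tauConj n (poleMat w k)
      = root n • tauConj n (poleMat w k) * (B w * (B w)⁻¹) := by
        rw [Matrix.mul_nonsing_inv _ hw, Matrix.mul_one]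
    _ = poleMat w k := by
        rw [← Matrix.mul_assoc, h3, Matrix.mul_assoc, Matrix.mul_nonsing_inv _ hw, Matrix.mul_one]

theorem tauConj_Ymat [NeZero n] {w : Fin n → ℂ} (k : ℂ) (hw : IsUnit (B w).det) :
    tauConj n (Ymat w k) = Ymat w k := by
  rw [Ymat_eq, map_neg, map_mul, tauConj_aMat, Matrix.smul_mul, ← Matrix.mul_smul,
    tauConj_poleMat k hw]

/-- Lifts the action on the single vector w to all its τ-translates: since q B(w) (ka)^e = q m^e
B(w), the number k becomes the matrix m. -/
theorem B_sum_mulVec [NeZero n] {ι : Type*} (t : Finset ι) (q : ι → Mat n) (e : ι → ℕ) (k : ℂ)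
    (hq : ∀ j ∈ t, tauConj n (q j) = root n ^ e j • q j) {w : Fin n → ℂ}
    (hw : IsUnit (B w).det) :
    B ((∑ j ∈ t, k ^ e j • q j) *ᵥ w) = (∑ j ∈ t, q j * poleMat w k ^ e j) * B w := by
  have hlin : B ((∑ j ∈ t, k ^ e j • q j) *ᵥ w) = ∑ j ∈ t, k ^ e j • B (q j *ᵥ w) := by
    ext i l
    simp only [B_apply, Matrix.sum_apply, Matrix.smul_apply, Matrix.sum_mulVec, Finset.sum_apply,
      Matrix.smul_mulVec, Pi.smul_apply]
  rw [hlin, Finset.sum_mul]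
  refine Finset.sum_congr rfl fun j hj => ?_
  rw [B_mulVec (hq j hj), Matrix.mul_assoc (q j) (poleMat w k ^ e j), poleMat_pow_mul_B k hw,
    Matrix.mul_smul, Matrix.mul_assoc]

/-- Evolution of the matrix `k B(w) a B(w)⁻¹` along `w = f⁻¹ v`, `f' = f ∑ k^(e_j) q_j`. -/
theorem hasDerivAt_poleMat [NeZero n] {f : ℝ → Mat n} {s : ℝ} {ι : Type*} (t : Finset ι)
    (q : ι → Mat n) (e : ι → ℕ) (k : ℂ) (hq : ∀ j ∈ t, tauConj n (q j) = root n ^ e j • q j)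
    (hf : HasDerivAt f (f s * ∑ j ∈ t, k ^ e j • q j) s) (hfs : IsUnit (f s).det)
    (v : Fin n → ℂ) (hw : IsUnit (B ((f s)⁻¹ *ᵥ v)).det) :
    HasDerivAt (fun r => poleMat ((f r)⁻¹ *ᵥ v) k)
      (poleMat ((f s)⁻¹ *ᵥ v) k * (∑ j ∈ t, q j * poleMat ((f s)⁻¹ *ᵥ v) k ^ e j) -
        (∑ j ∈ t, q j * poleMat ((f s)⁻¹ *ᵥ v) k ^ e j) * poleMat ((f s)⁻¹ *ᵥ v) k) s := by
  set w := (f s)⁻¹ *ᵥ v with hwdef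
  set H := ∑ j ∈ t, q j * poleMat w k ^ e j with hH
  -- B is linear in its vector, so B(w)' = B(w'), and w' = -(∑ k^{e_j} q_j) w.
  have h1 : HasDerivAt (fun r => B ((f r)⁻¹ *ᵥ v)) (-(H * B w)) s := by
    have h := hasDerivAt_B_mulVec (hasDerivAt_mat_inv hf hfs) v
    have hB : B (-((f s)⁻¹ * (f s * ∑ j ∈ t, k ^ e j • q j) * (f s)⁻¹) *ᵥ v) = -(H * B w) := by
      rw [← Matrix.mul_assoc, Matrix.nonsing_inv_mul _ hfs, Matrix.one_mul, Matrix.neg_mulVec,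
        ← Matrix.mulVec_mulVec, hH, ← B_sum_mulVec t q e k hq hw]
      ext i j
      simp [B_apply, hwdef]
    rwa [hB] at h
  have h2 := ((h1.mul_const (aMat n)).mul (hasDerivAt_mat_inv h1 hw)).const_smul k
  refine h2.congr_deriv ?_
  have hBB := Matrix.mul_nonsing_inv _ hw
  have e1 : (B w)⁻¹ * -(H * B w) * (B w)⁻¹ = -((B w)⁻¹ * H) := by
    rw [mul_neg, neg_mul, Matrix.mul_assoc, Matrix.mul_assoc, hBB, Matrix.mul_one]
  rw [e1, poleMat]
  simp only [neg_neg, neg_mul, smul_add, smul_neg, Matrix.smul_mul, Matrix.mul_smul,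
    Matrix.mul_assoc]
  rw [← sub_eq_neg_add]

end Evolution

/-! ### The Bäcklund system and the KW equation for ũ -/

section Backlund

attribute [local instance] Matrix.linftyOpNormedRing Matrix.linftyOpNormedAlgebra

variable {n : ℕ} {O₁ : Set (ℝ × ℝ)} {u : ℝ × ℝ → Mat n} {E : ℝ × ℝ → ℂ → Mat n}

/-- The vector `E(x, t, k)⁻¹ v`. -/
noncomputable def backVec (E : ℝ × ℝ → ℂ → Mat n) (k : ℂ) (v : Fin n → ℂ) (p : ℝ × ℝ) :
    Fin n → ℂ := (E p k)⁻¹ *ᵥ v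

/-- The set on which `B(ṽ)` is nonsingular. -/
def regularSet (O₁ : Set (ℝ × ℝ)) (E : ℝ × ℝ → ℂ → Mat n) (k : ℂ) (v : Fin n → ℂ) :
    Set (ℝ × ℝ) := {p | p ∈ O₁ ∧ IsUnit (B (backVec E k v p)).det}

/-- The matrix function `Ỹ`. -/
noncomputable def backY (E : ℝ × ℝ → ℂ → Mat n) (k : ℂ) (v : Fin n → ℂ) (p : ℝ × ℝ) : Mat n :=
  Ymat (backVec E k v p) k

theorem tauConj_of_mem_eigSpace_zero [NeZero n] {y : Mat n} :
    y ∈ eigSpace n 0 ↔ tauConj n y = y := by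
  rw [eigSpace, Set.mem_ofPred_eq, pow_zero, one_smul, tauConj_apply]

variable [NeZero n] {k : ℂ} {v : Fin n → ℂ}

theorem contDiffOn_B_backVec (hE : IsTrivialization n O₁ u E)
    (hdet : ∀ p ∈ O₁, IsUnit (E p k).det) :
    ContDiffOn ℝ ∞ (fun p => B (backVec E k v p)) O₁ :=
  contDiffOn_B_mulVec (contDiffOn_mat_inv (hE.smooth k) hdet) v

theorem isOpen_regularSet (hO : IsOpen O₁) (hE : IsTrivialization n O₁ u E)
    (hdet : ∀ p ∈ O₁, IsUnit (E p k).det) : IsOpen (regularSet O₁ E k v) := by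
  have hc : ContinuousOn (fun p => (B (backVec E k v p)).det) O₁ :=
    (Continuous.matrix_det continuous_id).comp_continuousOn
      (contDiffOn_B_backVec hE hdet).continuousOn
  have h := hc.isOpen_inter_preimage hO (t := {z : ℂ | z ≠ 0}) isOpen_ne
  convert h using 1
  ext p
  simp [regularSet, isUnit_iff_ne_zero]

theorem contDiffOn_poleMat (hE : IsTrivialization n O₁ u E)
    (hdet : ∀ p ∈ O₁, IsUnit (E p k).det) :
    ContDiffOn ℝ ∞ (fun p => poleMat (backVec E k v p) k) (regularSet O₁ E k v) := by
  have hB : ContDiffOn ℝ ∞ (fun p => B (backVec E k v p)) (regularSet O₁ E k v) :=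
    (contDiffOn_B_backVec hE hdet).mono fun p hp => hp.1
  exact ((hB.mul contDiffOn_const).mul (contDiffOn_mat_inv hB fun p hp => hp.2)).const_smul k

theorem contDiffOn_backY (hE : IsTrivialization n O₁ u E)
    (hdet : ∀ p ∈ O₁, IsUnit (E p k).det) :
    ContDiffOn ℝ ∞ (backY E k v) (regularSet O₁ E k v) := by
  have h := (contDiffOn_const (c := aMat n)).mul (contDiffOn_poleMat (v := v) hE hdet)
  exact h.neg.congr fun p _ => Ymat_eq _ _

theorem dx_backY (hO : IsOpen O₁) (hτ : ∀ p ∈ O₁, tauConj n (u p) = u p)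
    (hE : IsTrivialization n O₁ u E) (hdet : ∀ p ∈ O₁, IsUnit (E p k).det) {p : ℝ × ℝ}
    (hp : p ∈ regularSet O₁ E k v) :
    dx (backY E k v) p = backY E k v p * u p - transform u (backY E k v) p * backY E k v p := by
  have hd := hasDerivAt_dx hO (hE.smooth k) hp.1
  rw [hE.eqn_x k p hp.1] at hd
  -- The coefficient ak + u is the two-term sum with q₀ = a of weight 1 and q₁ = u of weight 0, so H
  -- = am + u.
  have h := hasDerivAt_poleMat (n := n) (s := p.1) (f := fun s => E (s, p.2) k)
    (Finset.range 2) (fun j => if j = 0 then aMat n else u p) (fun j => 1 - j) k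
    (fun j hj => by
      rcases Nat.lt_succ_iff_lt_or_eq.1 (Finset.mem_range.1 hj) with h | h
      · rw [Nat.lt_one_iff.1 h, if_pos rfl, tauConj_aMat]; simp
      · rw [h, if_neg one_ne_zero, hτ p hp.1]; simp)
    (by simpa [Finset.sum_range_succ] using hd) (hdet p hp.1) v hp.2
  have h2 := (h.const_mul (aMat n)).neg.congr_of_eventuallyEq
    (f₁ := fun s => backY E k v (s, p.2)) (Filter.Eventually.of_forall fun s => Ymat_eq _ _)
  have h3 : dx (backY E k v) p = _ := h2.deriv
  rw [h3]
  simp only [Finset.sum_range_succ, Finset.sum_range_zero, zero_add, if_true, Nat.sub_zero,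
    pow_one, one_ne_zero, if_false, Nat.sub_self, pow_zero, mul_one]
  have hY : backY E k v p = -(aMat n * poleMat ((E p k)⁻¹ *ᵥ v) k) := Ymat_eq _ _
  set m := poleMat ((E p k)⁻¹ *ᵥ v) k with hm
  have hT : transform u (backY E k v) p * backY E k v p = -(transform u (backY E k v) p * aMat n
      * m) := by
    rw [hY, mul_neg, ← mul_assoc]
  rw [hT, transform_mul_aMat, hY]
  noncomm_ring

/-- Right substitution of m for λ in the Lax polynomial. As am + Y = 0, the intermediate terms
cancel and only the top coefficients survive. -/
theorem backlund_telescope {R : Type*} [Ring R] {a m Y : R} (hY : Y = -(a * m))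
    {q qt : ℕ → R} (h0 : q 0 = a) (ht0 : qt 0 = a) {N : ℕ}
    (hrel : ∀ j < N, qt (j + 1) * a + qt j * Y = a * q (j + 1) + Y * q j) :
    -(a * (m * (∑ j ∈ Finset.range (N + 1), q j * m ^ (N - j)) -
      (∑ j ∈ Finset.range (N + 1), q j * m ^ (N - j)) * m)) = Y * q N - qt N * Y := by
  -- Induction by Horner's rule H_{M+1} = H_M m + q_{M+1}.
  have key : ∀ M ≤ N, a * (∑ j ∈ Finset.range (M + 1), q j * m ^ (M - j)) * m +
      Y * (∑ j ∈ Finset.range (M + 1), q j * m ^ (M - j)) = Y * q M - qt M * Y := by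
    intro M hM
    induction M with
    | zero => simp [h0, ht0, hY, mul_assoc, add_comm]
    | succ M ih =>
      have hsum : ∑ j ∈ Finset.range (M + 1 + 1), q j * m ^ (M + 1 - j) =
          (∑ j ∈ Finset.range (M + 1), q j * m ^ (M - j)) * m + q (M + 1) := by
        rw [Finset.sum_range_succ, Nat.sub_self, pow_zero, mul_one, Finset.sum_mul]
        congr 1
        refine Finset.sum_congr rfl fun j hj => ?_
        rw [mul_assoc, ← pow_succ, Nat.sub_add_comm (Nat.lt_succ_iff.1 (Finset.mem_range.1 hj))]
      rw [hsum]
      set H := ∑ j ∈ Finset.range (M + 1), q j * m ^ (M - j)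
      have hr := hrel M hM
      have h1 : a * (H * m + q (M + 1)) * m + Y * (H * m + q (M + 1)) =
          (a * H * m + Y * H) * m + a * q (M + 1) * m + Y * q (M + 1) := by noncomm_ring
      have h2 : a * q (M + 1) = qt (M + 1) * a + qt M * Y - Y * q M := by rw [hr]; abel
      rw [h1, ih (Nat.le_of_succ_le hM), h2, hY]
      noncomm_ring
  rw [← key N le_rfl, hY]
  noncomm_ring

theorem dt_backY (hO : IsOpen O₁) (hu : ContDiffOn ℝ ∞ u O₁)
    (hτ : ∀ p ∈ O₁, tauConj n (u p) = u p)
    (hE : IsTrivialization n O₁ u E) (hdet : ∀ p ∈ O₁, IsUnit (E p k).det) {p : ℝ × ℝ}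
    (hp : p ∈ regularSet O₁ E k v) :
    dt (backY E k v) p = backY E k v p * Q u (n + 1) p -
      Q (transform u (backY E k v)) (n + 1) p * backY E k v p := by
  have hd := hasDerivAt_dt hO (hE.smooth k) hp.1
  rw [hE.eqn_t k p hp.1] at hd
  have h := hasDerivAt_poleMat (n := n) (s := p.2) (f := fun s => E (p.1, s) k)
    (Finset.range (n + 2)) (fun j => Q u j p) (fun j => n + 1 - j) k
    (fun j hj => tauConj_laxV hO hu hτ hp.1 (Nat.lt_succ_iff.1 (Finset.mem_range.1 hj)))
    hd (hdet p hp.1) v hp.2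
  have h2 := (h.const_mul (aMat n)).neg.congr_of_eventuallyEq
    (f₁ := fun s => backY E k v (p.1, s)) (Filter.Eventually.of_forall fun s => Ymat_eq _ _)
  have h3 : dt (backY E k v) p = _ := h2.deriv
  rw [h3]
  have hsub : regularSet O₁ E k v ⊆ O₁ := fun q hq => hq.1
  exact backlund_telescope (a := aMat n) (Y := backY E k v p) (Ymat_eq _ _)
    (q := fun j => Q u j p) (qt := fun j => Q (transform u (backY E k v)) j p) (Q_zero _ _)
    (Q_zero _ _) (N := n + 1) fun j _ =>
      Q_transform_relation (isOpen_regularSet hO hE hdet) (hu.mono hsub) (contDiffOn_backY hE hdet)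
        (fun q hq => dx_backY hO hτ hE hdet hq) hp j

theorem isBacklundSolution_backY (hO : IsOpen O₁) (hu : ContDiffOn ℝ ∞ u O₁)
    (hτ : ∀ p ∈ O₁, tauConj n (u p) = u p)
    (hE : IsTrivialization n O₁ u E) (hdet : ∀ p ∈ O₁, IsUnit (E p k).det) :
    IsBacklundSolution n (regularSet O₁ E k v) u (backY E k v) where
  smooth := contDiffOn_backY hE hdet
  eqn_x _ hp := dx_backY hO hτ hE hdet hp
  eqn_t _ hp := dt_backY hO hu hτ hE hdet hp
  reality _ hp := tauConj_Ymat k hp.2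

omit [NeZero n] in
theorem IsSolution.mono {O : Set (ℝ × ℝ)} (hu : IsSolution n O₁ u) (h : O ⊆ O₁) :
    IsSolution n O u :=
  ⟨hu.smooth.mono h, fun p hp => hu.mem p (h hp), fun p hp => hu.eqn p (h hp)⟩

/-- A Bäcklund transformation maps solutions to solutions. -/
theorem IsBacklundSolution.isSolution_transform {O : Set (ℝ × ℝ)} {Y : ℝ × ℝ → Mat n}
    (hO : IsOpen O) (hu : IsSolution n O u) (hY : IsBacklundSolution n O u Y) :
    IsSolution n O (transform u Y) where
  smooth := contDiffOn_transform hu.smooth hY.smooth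
  mem p hp := by
    have hτu := tauConj_of_mem_eigSpace_zero.1 (hu.mem p hp).1
    have hτY : tauConj n (Y p) = Y p := hY.reality p hp
    refine ⟨tauConj_of_mem_eigSpace_zero.2 ?_, mem_slPerp_of_diag fun i => ?_⟩
    · rw [transform]
      simp only [map_add, map_sub, map_mul, hτu, hτY, tauConj_aMat, tauConj_aMat_inv,
        Matrix.smul_mul, Matrix.mul_smul, smul_smul, ← smul_sub,
        inv_mul_cancel₀ (root_ne_zero (n := n)), one_smul]
    · have h1 : (transform u Y p * aMat n) i i = 0 := by
        rw [transform_mul_aMat, Matrix.add_apply, commutator_aMat_apply, sub_self, mul_zero,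
          add_zero, aMat, Matrix.diagonal_mul, slPerp_diag (hu.mem p hp).2, mul_zero]
      rw [aMat, Matrix.mul_diagonal] at h1
      exact (mul_eq_zero.1 h1).resolve_right (pow_ne_zero _ root_ne_zero)
  eqn p hp := by
    set ut := transform u Y with hut
    have huts : ContDiffOn ℝ ∞ ut O := contDiffOn_transform hu.smooth hY.smooth
    have hrel := Q_transform_relation hO hu.smooth hY.smooth hY.eqn_x hp (n + 1)
    have hr := Q_recursion hO hu.smooth hp (n + 1)
    have hrt := Q_recursion hO huts hp (n + 1)
    rw [← hut] at hrel
    -- With u_t = [Q_{n+2}(u), a] the right side collapses, by the relation at level n + 1, to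
    -- [Q_{n+2}(ũ), a] a; then a is cancelled.
    have hdt : dt ut p * aMat n = aMat n * dt u p + (dt Y p * aMat n - aMat n * dt Y p) := by
      have h1 := (hasDerivAt_dt hO huts hp).mul_const (aMat n)
      have h2 := ((hasDerivAt_dt hO hu.smooth hp).const_mul (aMat n)).add
        (((hasDerivAt_dt hO hY.smooth hp).mul_const (aMat n)).sub
          ((hasDerivAt_dt hO hY.smooth hp).const_mul (aMat n)))
      refine h1.unique (h2.congr_of_eventuallyEq (Filter.Eventually.of_forall fun s => ?_))
      exact transform_mul_aMat _
    rw [hu.eqn p hp, hr, hY.eqn_t p hp, ← hut] at hdt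
    rw [hrt]
    have hcancel : ∀ x y : Mat n, x * aMat n = y * aMat n → x = y := fun x y h => by
      rw [← Matrix.mul_one x, ← Matrix.mul_one y, ← aMat_mul_inv, ← Matrix.mul_assoc, h,
        Matrix.mul_assoc]
    refine hcancel _ _ (hdt.trans ?_)
    have h3 : Q ut (n + 1 + 1) p * aMat n =
        aMat n * Q u (n + 1 + 1) p + Y p * Q u (n + 1) p - Q ut (n + 1) p * Y p := by
      rw [← hrel]; abel
    rw [sub_mul (Q ut (n + 1 + 1) p * aMat n), mul_assoc (aMat n) (Q ut (n + 1 + 1) p), h3]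
    noncomm_ring

end Backlund

/-! ### The dressed trivialization and its removable singularities -/

section Dressing

attribute [local instance] Matrix.linftyOpNormedRing Matrix.linftyOpNormedAlgebra

open Filter Topology

variable {n : ℕ} {O₁ : Set (ℝ × ℝ)} {u : ℝ × ℝ → Mat n} {E : ℝ × ℝ → ℂ → Mat n}
  {k : ℂ} {v w : Fin n → ℂ}

theorem pMat_eq (w : Fin n → ℂ) (k z : ℂ) :
    pMat w k z = aMat n * (z • (1 : Mat n) - poleMat w k) := by
  rw [pMat, Ymat_eq, mul_sub, Matrix.mul_smul, Matrix.mul_one, sub_eq_add_neg]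

theorem sub_poleMat_mul_B (hw : IsUnit (B w).det) (z : ℂ) :
    (z • (1 : Mat n) - poleMat w k) * B w =
      B w * diagonal fun j : Fin n => z - root n ^ (j : ℕ) * k := by
  rw [sub_mul, poleMat_mul_B k hw]
  ext i j
  rw [Matrix.mul_diagonal, Matrix.sub_apply, Matrix.smul_mul, Matrix.one_mul, Matrix.smul_apply,
    Matrix.smul_apply, aMat, Matrix.mul_diagonal]
  simp only [smul_eq_mul]
  ring

/-- The right side does not involve w, so the determinants of p_v and p_ṽ agree. -/
theorem det_pMat (hw : IsUnit (B w).det) (z : ℂ) :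
    (pMat w k z).det = (aMat n).det * ∏ j : Fin n, (z - root n ^ (j : ℕ) * k) := by
  have h := congrArg Matrix.det (sub_poleMat_mul_B (k := k) hw z)
  rw [Matrix.det_mul, Matrix.det_mul, mul_comm] at h
  rw [pMat_eq, Matrix.det_mul, hw.mul_left_cancel h, Matrix.det_diagonal]

theorem isUnit_det_pMat [NeZero n] (hw : IsUnit (B w).det) {z : ℂ} (hz : z ^ n ≠ k ^ n) :
    IsUnit (pMat w k z).det := by
  rw [det_pMat hw]
  refine isUnit_det_aMat.mul (isUnit_iff_ne_zero.2 (Finset.prod_ne_zero_iff.2 fun j _ h => hz ?_))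
  rw [sub_eq_zero.1 h, mul_pow, ← pow_mul, mul_comm (j : ℕ), pow_mul, root_pow_self, one_pow,
    one_mul]

theorem eventually_pow_ne [NeZero n] (k z₀ : ℂ) : ∀ᶠ z in 𝓝[≠] z₀, z ^ n ≠ k ^ n := by
  have hfin : {z : ℂ | z ^ n = k ^ n}.Finite := by
    refine (Polynomial.nthRoots n (k ^ n)).toFinset.finite_toSet.subset fun z hz => ?_
    simpa [Polynomial.mem_nthRoots (NeZero.pos n)] using hz
  have h := (hfin.subset (Set.sdiff_subset (t := {z₀}))).isClosed.isOpen_compl.mem_nhds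
    (x := z₀) (fun h => h.2 rfl)
  filter_upwards [mem_nhdsWithin_of_mem_nhds h, self_mem_nhdsWithin] with z h1 h2 h3
  exact h1 ⟨h3, h2⟩

theorem eq_of_eq_generic [NeZero n] {X : Type*} [TopologicalSpace X] [T2Space X] {f g : ℂ → X}
    (hf : Continuous f) (hg : Continuous g) (h : ∀ z, z ^ n ≠ k ^ n → f z = g z) (z : ℂ) :
    f z = g z := by
  refine tendsto_nhds_unique_of_eventuallyEq (hf.continuousAt.tendsto.mono_left nhdsWithin_le_nhds)
    (hg.continuousAt.tendsto.mono_left nhdsWithin_le_nhds) (l := 𝓝[≠] z) ?_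
  exact (eventually_pow_ne k z).mono fun z hz => h z hz

/-- The entire function `(z - m_v) E(p, z) B(ṽ)`. -/
noncomputable def dressNum (E : ℝ × ℝ → ℂ → Mat n) (k : ℂ) (v : Fin n → ℂ) (p : ℝ × ℝ)
    (z : ℂ) : Mat n :=
  (z • (1 : Mat n) - poleMat v k) * E p z * B (backVec E k v p)

/-- The dressed trivialization, with the removable singularities removed. -/
noncomputable def dressE (E : ℝ × ℝ → ℂ → Mat n) (k : ℂ) (v : Fin n → ℂ) (p : ℝ × ℝ)
    (z : ℂ) : Mat n :=
  aMat n * (Matrix.of fun i j : Fin n =>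
    dslope (fun x => dressNum E k v p x i j) (root n ^ (j : ℕ) * k) z) *
      (B (backVec E k v p))⁻¹ * (aMat n)⁻¹

/-- By the symmetry, E(α^j k) carries column j of B(ṽ) to column j of B(v), an eigenvector of m_v
with eigenvalue α^j k. -/
theorem dressNum_root [NeZero n] (hv : IsUnit (B v).det) {p : ℝ × ℝ}
    (hEk : IsUnit (E p k).det) (hsymm : ∀ j : ℕ, E p (root n ^ j * k) * (tau n)⁻¹ ^ j =
      (tau n)⁻¹ ^ j * E p k) (i j : Fin n) :
    dressNum E k v p (root n ^ (j : ℕ) * k) i j = 0 := by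
  have h1 : ∀ l, (E p (root n ^ (j : ℕ) * k) * B (backVec E k v p)) l j = B v l j := fun l => by
    rw [mul_B_col (hsymm j), backVec, Matrix.mulVec_mulVec, Matrix.mul_nonsing_inv _ hEk,
      Matrix.one_mulVec]
  rw [dressNum, Matrix.mul_assoc, Matrix.mul_apply]
  simp only [h1]
  rw [← Matrix.mul_apply, sub_poleMat_mul_B hv, Matrix.mul_diagonal, sub_self, mul_zero]

theorem dressE_mul_pMat [NeZero n] (hv : IsUnit (B v).det) {p : ℝ × ℝ}
    (hEk : IsUnit (E p k).det) (hw : IsUnit (B (backVec E k v p)).det)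
    (hsymm : ∀ j : ℕ, E p (root n ^ j * k) * (tau n)⁻¹ ^ j = (tau n)⁻¹ ^ j * E p k) (z : ℂ) :
    dressE E k v p z * pMat (backVec E k v p) k z = pMat v k z * E p z := by
  -- Multiplying column j by z - α^j k undoes the divided difference, because the numerator vanishes
  -- at the base point.
  have hT : (Matrix.of fun i j : Fin n =>
      dslope (fun x => dressNum E k v p x i j) (root n ^ (j : ℕ) * k) z) *
      (diagonal fun j : Fin n => z - root n ^ (j : ℕ) * k) = dressNum E k v p z := by
    ext i j
    rw [Matrix.mul_diagonal, Matrix.of_apply, mul_comm, ← smul_eq_mul, sub_smul_dslope,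
      dressNum_root hv hEk hsymm, sub_zero]
  have hD : (B (backVec E k v p))⁻¹ * (z • (1 : Mat n) - poleMat (backVec E k v p) k) =
      (diagonal fun j : Fin n => z - root n ^ (j : ℕ) * k) * (B (backVec E k v p))⁻¹ := by
    calc (B (backVec E k v p))⁻¹ * (z • (1 : Mat n) - poleMat (backVec E k v p) k)
        = (B (backVec E k v p))⁻¹ * ((z • (1 : Mat n) - poleMat (backVec E k v p) k) *
            B (backVec E k v p)) * (B (backVec E k v p))⁻¹ := by
          rw [Matrix.mul_assoc, Matrix.mul_assoc, Matrix.mul_nonsing_inv _ hw, Matrix.mul_one]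
      _ = _ := by
          rw [sub_poleMat_mul_B hw, ← Matrix.mul_assoc, Matrix.nonsing_inv_mul _ hw,
            Matrix.one_mul]
  rw [pMat_eq, dressE, Matrix.mul_assoc _ (aMat n)⁻¹, ← Matrix.mul_assoc (aMat n)⁻¹, aMat_inv_mul,
    Matrix.one_mul, Matrix.mul_assoc, hD, Matrix.mul_assoc (aMat n), ← Matrix.mul_assoc _ _ _⁻¹,
    hT, dressNum, Matrix.mul_assoc _ (B _), Matrix.mul_nonsing_inv _ hw, Matrix.mul_one, pMat_eq,
    Matrix.mul_assoc]

theorem dressE_eq [NeZero n] (hv : IsUnit (B v).det) {p : ℝ × ℝ}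
    (hEk : IsUnit (E p k).det) (hw : IsUnit (B (backVec E k v p)).det)
    (hsymm : ∀ j : ℕ, E p (root n ^ j * k) * (tau n)⁻¹ ^ j = (tau n)⁻¹ ^ j * E p k) {z : ℂ}
    (hz : z ^ n ≠ k ^ n) :
    dressE E k v p z = pMat v k z * E p z * (pMat (backVec E k v p) k z)⁻¹ := by
  rw [← dressE_mul_pMat hv hEk hw hsymm, Matrix.mul_assoc,
    Matrix.mul_nonsing_inv _ (isUnit_det_pMat hw hz), Matrix.mul_one]

theorem differentiable_entry {f : ℂ → Mat n} (hf : Differentiable ℂ f) (i j : Fin n) :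
    Differentiable ℂ fun z => f z i j := fun z =>
  (differentiableAt_pi.1 (differentiableAt_pi.1 (hf z) i) j)

theorem differentiable_of_entries {f : ℂ → Mat n}
    (hf : ∀ i j, Differentiable ℂ fun z => f z i j) : Differentiable ℂ f := by
  have h : f = fun z => ∑ i, ∑ j, f z i j • Matrix.single i j (1 : ℂ) := by
    ext1 z
    conv_lhs => rw [Matrix.matrix_eq_sum_single (f z)]
    simp
  rw [h]
  exact Differentiable.fun_sum fun i _ => Differentiable.fun_sum fun j _ =>
    (hf i j).smul_const _

theorem differentiable_dressE {p : ℝ × ℝ} (hEp : Differentiable ℂ (E p)) :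
    Differentiable ℂ (dressE E k v p) := by
  have hnum : Differentiable ℂ (dressNum E k v p) :=
    (((differentiable_id.smul_const (1 : Mat n)).sub_const _).mul hEp).mul_const _
  refine Differentiable.mul_const (Differentiable.mul_const (Differentiable.const_mul
    (differentiable_of_entries fun i j => ?_) _) _) _
  simp only [Matrix.of_apply]
  rw [← differentiableOn_univ, Complex.differentiableOn_dslope univ_mem]
  exact (differentiable_entry hnum i j).differentiableOn

/-- The factors p_v and p_ṽ have equal determinants, so det Ẽ = det E for generic λ, and for every λ
by continuity. -/
theorem isUnit_det_dressE [NeZero n] (hv : IsUnit (B v).det) {p : ℝ × ℝ}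
    (hEp : Differentiable ℂ (E p)) (hE : ∀ z, IsUnit (E p z).det)
    (hw : IsUnit (B (backVec E k v p)).det)
    (hsymm : ∀ j : ℕ, E p (root n ^ j * k) * (tau n)⁻¹ ^ j = (tau n)⁻¹ ^ j * E p k) (z : ℂ) :
    IsUnit (dressE E k v p z).det := by
  have hdet : Continuous (Matrix.det : Mat n → ℂ) := Continuous.matrix_det continuous_id
  have h := eq_of_eq_generic (n := n) (k := k)
    (hdet.comp (differentiable_dressE (k := k) (v := v) hEp).continuous)
    (hdet.comp hEp.continuous) (fun z hz => ?_) z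
  · have h' : (dressE E k v p z).det = (E p z).det := h
    rw [h']
    exact hE z
  · have h1 := congrArg Matrix.det (dressE_mul_pMat hv (hE k) hw hsymm z)
    rw [Matrix.det_mul, Matrix.det_mul, det_pMat hv, ← det_pMat hw, mul_comm] at h1
    exact (isUnit_det_pMat hw hz).mul_left_cancel h1

/-- The polynomial part of the series identity Ṽ(a + YX) = (a + YX)V; only the truncation at order N
leaves a remainder, which is Y_t. -/
theorem lax_telescope {R : Type*} [Ring R] [Algebra ℂ R] {a Y : R} (z : ℂ)
    {q qt : ℕ → R} (h0 : q 0 = a) (ht0 : qt 0 = a) {N : ℕ}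
    (hrel : ∀ j < N, qt (j + 1) * a + qt j * Y = a * q (j + 1) + Y * q j) :
    (z • a + Y) * (∑ j ∈ Finset.range (N + 1), z ^ (N - j) • q j) -
      (∑ j ∈ Finset.range (N + 1), z ^ (N - j) • qt j) * (z • a + Y) = Y * q N - qt N * Y := by
  have hsum : ∀ (M : ℕ) (c : ℕ → R), ∑ j ∈ Finset.range (M + 1 + 1), z ^ (M + 1 - j) • c j =
      z • (∑ j ∈ Finset.range (M + 1), z ^ (M - j) • c j) + c (M + 1) := by
    intro M c
    rw [Finset.sum_range_succ, Nat.sub_self, pow_zero, one_smul, Finset.smul_sum]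
    congr 1
    refine Finset.sum_congr rfl fun j hj => ?_
    rw [smul_smul, ← pow_succ', Nat.sub_add_comm (Nat.lt_succ_iff.1 (Finset.mem_range.1 hj))]
  induction N with
  | zero => simp [h0, ht0, add_mul, mul_add]
  | succ N ih =>
    have ih := ih fun j hj => hrel j (Nat.lt_succ_of_lt hj)
    rw [hsum, hsum]
    set S := ∑ j ∈ Finset.range (N + 1), z ^ (N - j) • q j
    set St := ∑ j ∈ Finset.range (N + 1), z ^ (N - j) • qt j
    have hr := hrel N (Nat.lt_succ_self N)
    have h1 : (z • a + Y) * (z • S + q (N + 1)) - (z • St + qt (N + 1)) * (z • a + Y) =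
        z • ((z • a + Y) * S - St * (z • a + Y)) + z • (a * q (N + 1) - qt (N + 1) * a) +
          (Y * q (N + 1) - qt (N + 1) * Y) := by
      simp only [mul_add, add_mul, smul_sub, smul_add, smul_mul_assoc, mul_smul_comm]
      abel
    have h2 : a * q (N + 1) - qt (N + 1) * a = qt N * Y - Y * q N := by
      rw [sub_eq_sub_iff_add_eq_add, ← hr]; abel
    rw [h1, ih, h2, ← smul_add, sub_add_sub_cancel, sub_self, smul_zero, zero_add]

theorem hasDerivAt_gauge {F P : ℝ → Mat n} {A At : Mat n} {s : ℝ} (C : Mat n)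
    (hF : HasDerivAt F (F s * A) s) (hP : HasDerivAt P (P s * A - At * P s) s)
    (hu : IsUnit (P s).det) :
    HasDerivAt (fun t => C * F t * (P t)⁻¹) (C * F s * (P s)⁻¹ * At) s := by
  refine ((hF.const_mul C).mul (hasDerivAt_mat_inv hP hu)).congr_deriv ?_
  have h1 : (P s)⁻¹ * (P s * A - At * P s) * (P s)⁻¹ = A * (P s)⁻¹ - (P s)⁻¹ * At := by
    rw [mul_sub, sub_mul, ← mul_assoc, Matrix.nonsing_inv_mul _ hu, one_mul, ← mul_assoc,
      mul_assoc _ (P s), Matrix.mul_nonsing_inv _ hu, mul_one]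
  rw [h1]
  noncomm_ring

theorem RightSolvesOn.congr {R : Type*} [NormedRing R] [NormedAlgebra ℝ R] {A V F G : ℝ × ℝ → R}
    {O : Set (ℝ × ℝ)} (hO : IsOpen O) (hF : RightSolvesOn A V F O) (h : ∀ p ∈ O, G p = F p) :
    RightSolvesOn A V G O := fun p hp => by
  have h1 : G =ᶠ[𝓝 p] F := by
    filter_upwards [hO.mem_nhds hp] with q hq using h q hq
  simp only [h p hp]
  exact (hF p hp).congr_of_eventuallyEq h1

theorem rightSolvesOn_dressE_generic [NeZero n] (hO : IsOpen O₁) (hu : ContDiffOn ℝ ∞ u O₁)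
    (hE : IsTrivialization n O₁ u E) (hdet : ∀ p ∈ O₁, ∀ z, IsUnit (E p z).det)
    (hτ : ∀ p ∈ O₁, tauConj n (u p) = u p) {z : ℂ} (hz : z ^ n ≠ k ^ n) :
    RightSolvesOn (laxA (transform u (backY E k v)) z) (laxV (transform u (backY E k v)) z)
      (fun p => pMat v k z * E p z * (pMat (backVec E k v p) k z)⁻¹) (regularSet O₁ E k v) := by
  set O := regularSet O₁ E k v with hOdef
  have hOo : IsOpen O := isOpen_regularSet hO hE fun p hp => hdet p hp k
  have hY := isBacklundSolution_backY (v := v) hO hu hτ hE fun p hp => hdet p hp k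
  have hsub : O ⊆ O₁ := fun q hq => hq.1
  have hPs : ContDiffOn ℝ ∞ (fun p => pMat (backVec E k v p) k z) O :=
    contDiffOn_const.add hY.smooth
  have hPu : ∀ p ∈ O, IsUnit (pMat (backVec E k v p) k z).det := fun p hp =>
    isUnit_det_pMat hp.2 hz
  have hs : ContDiffOn ℝ ∞
      (fun p => pMat v k z * E p z * (pMat (backVec E k v p) k z)⁻¹) O :=
    (contDiffOn_const.mul ((hE.smooth z).mono hsub)).mul (contDiffOn_mat_inv hPs hPu)
  refine (rightSolvesOn_iff hOo hs).2 fun p hp => ⟨?_, ?_⟩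
  · have h1 := hasDerivAt_dx hO (hE.smooth z) (hsub hp)
    rw [hE.eqn_x z p (hsub hp)] at h1
    have h2 := hasDerivAt_dx hOo hY.smooth hp
    have h3 : dx (backY E k v) p = pMat (backVec E k v p) k z * (z • aMat n + u p) -
        laxA (transform u (backY E k v)) z p * pMat (backVec E k v p) k z := by
      rw [hY.eqn_x p hp, laxA, pMat, ← backY]
      have ht := transform_mul_aMat (u := u) (Y := backY E k v) p
      simp only [mul_add, add_mul, Matrix.smul_mul, Matrix.mul_smul, ht, smul_add, smul_sub]
      abel
    rw [h3] at h2
    exact (hasDerivAt_gauge (pMat v k z) h1 (h2.const_add (z • aMat n)) (hPu p hp)).deriv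
  · have h1 := hasDerivAt_dt hO (hE.smooth z) (hsub hp)
    rw [hE.eqn_t z p (hsub hp)] at h1
    have h2 := hasDerivAt_dt hOo hY.smooth hp
    have h3 : dt (backY E k v) p = pMat (backVec E k v p) k z *
        (∑ j ∈ Finset.range (n + 2), z ^ (n + 1 - j) • Q u j p) -
        laxV (transform u (backY E k v)) z p * pMat (backVec E k v p) k z := by
      rw [hY.eqn_t p hp]
      exact (lax_telescope z (q := fun j => Q u j p)
        (qt := fun j => Q (transform u (backY E k v)) j p) (Q_zero _ _)
        (Q_zero _ _) (N := n + 1) fun j _ => Q_transform_relation hOo (hu.mono hsub) hY.smooth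
          hY.eqn_x hp j).symm
    rw [h3] at h2
    exact (hasDerivAt_gauge (pMat v k z) h1 (h2.const_add (z • aMat n)) (hPu p hp)).deriv

theorem isTrivialization_dressE [NeZero n] (hO : IsOpen O₁) (hu : ContDiffOn ℝ ∞ u O₁)
    (hE : IsTrivialization n O₁ u E) (hdet : ∀ p ∈ O₁, ∀ z, IsUnit (E p z).det)
    (hdiff : ∀ p ∈ O₁, Differentiable ℂ (E p)) (hτ : ∀ p ∈ O₁, tauConj n (u p) = u p)
    (hsymm : ∀ p ∈ O₁, ∀ j : ℕ,
      E p (root n ^ j * k) * (tau n)⁻¹ ^ j = (tau n)⁻¹ ^ j * E p k)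
    (h0 : (0, 0) ∈ O₁) (hv : IsUnit (B v).det) :
    IsTrivialization n (regularSet O₁ E k v) (transform u (backY E k v)) (dressE E k v) := by
  set O := regularSet O₁ E k v with hOdef
  have hOo : IsOpen O := isOpen_regularSet hO hE fun p hp => hdet p hp k
  have hY := isBacklundSolution_backY (v := v) hO hu hτ hE fun p hp => hdet p hp k
  have hut : ContDiffOn ℝ ∞ (transform u (backY E k v)) O :=
    contDiffOn_transform (hu.mono fun q hq => hq.1) hY.smooth
  have hgen : ∀ z, z ^ n ≠ k ^ n → RightSolvesOn (laxA (transform u (backY E k v)) z)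
      (laxV (transform u (backY E k v)) z) (fun p => dressE E k v p z) O := fun z hz =>
    (rightSolvesOn_dressE_generic hO hu hE hdet hτ hz).congr hOo fun p hp =>
      dressE_eq hv (hdet p hp.1 k) hp.2 (hsymm p hp.1) hz
  have hall : ∀ z, RightSolvesOn (laxA (transform u (backY E k v)) z)
      (laxV (transform u (backY E k v)) z) (fun p => dressE E k v p z) O := fun z =>
    -- The exceptional λ are isolated and the extended Ẽ is continuous in λ, so the equations pass
    -- to the limit.
    RightSolvesOn.of_punctured hOo z ((eventually_pow_ne k z).mono hgen) (continuousOn_laxA hut)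
      (continuousOn_laxV hOo hut)
      fun p hp => (differentiable_dressE (hdiff p hp.1)).continuous.continuousAt
  have hs : ∀ z, ContDiffOn ℝ ∞ (fun p => dressE E k v p z) O := fun z =>
    (hall z).contDiffOn hOo (contDiffOn_laxA hut z) (contDiffOn_laxV hOo hut z)
  refine ⟨hs, fun z p hp => ((rightSolvesOn_iff hOo (hs z)).1 (hall z) p hp).1,
    fun z p hp => ((rightSolvesOn_iff hOo (hs z)).1 (hall z) p hp).2, fun z => ?_⟩
  -- At the origin ṽ = v, so p_v and p_ṽ⁻¹ cancel for generic λ, and continuity gives the remaining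
  -- values.
  have hw : backVec E k v (0, 0) = v := by
    rw [backVec, hE.normalized, inv_one, Matrix.one_mulVec]
  refine eq_of_eq_generic (n := n) (k := k)
    (differentiable_dressE (k := k) (v := v) (hdiff _ h0)).continuous continuous_const
    (fun z hz => ?_) z
  rw [dressE_eq hv (hdet _ h0 k) (by rwa [hw]) (hsymm _ h0) hz, hw, hE.normalized, Matrix.mul_one,
    Matrix.mul_nonsing_inv _ (isUnit_det_pMat hv hz)]

end Dressing

end KW

theorem theorem13p12 (n : ℕ) (hn : 2 ≤ n)
    (O₁ : Set (ℝ × ℝ)) (hopen : IsOpen O₁) (hconn : IsPreconnected O₁) (hzero : (0, 0) ∈ O₁)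
    (u : ℝ × ℝ → KW.Mat n) (hu : KW.IsSolution n O₁ u)
    (E : ℝ × ℝ → ℂ → KW.Mat n) (hE : KW.IsTrivialization n O₁ u E)
    (v : Fin n → ℂ) (k : ℂ) (hk : k ≠ 0) (hv : IsUnit (KW.B v).det)
    (vt : ℝ × ℝ → Fin n → ℂ) (hvt : vt = fun p => (E p k)⁻¹ *ᵥ v)
    (O : Set (ℝ × ℝ)) (hO : O = {p | p ∈ O₁ ∧ IsUnit (KW.B (vt p)).det})
    (Yt ut : ℝ × ℝ → KW.Mat n) (hYt : Yt = fun p => KW.Ymat (vt p) k)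
    (hut : ut = KW.transform u Yt) :
    (∀ p ∈ O₁, IsUnit (E p k).det) ∧
    IsOpen O ∧ (0, 0) ∈ O ∧
    KW.IsSolution n O ut ∧
    (∃ Et : ℝ × ℝ → ℂ → KW.Mat n,
      KW.IsTrivialization n O ut Et ∧
      (∀ p ∈ O, Differentiable ℂ (Et p)) ∧
      (∀ p ∈ O, ∀ z : ℂ, IsUnit (Et p z).det) ∧
      (∀ p ∈ O, ∀ z : ℂ, z ^ n ≠ k ^ n →
        Et p z = KW.pMat v k z * E p z * (KW.pMat (vt p) k z)⁻¹)) ∧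
    KW.IsBacklundSolution n O u Yt := by
  have : NeZero n := ⟨by omega⟩
  have hτ : ∀ p ∈ O₁, KW.tauConj n (u p) = u p := fun p hp =>
    KW.tauConj_of_mem_eigSpace_zero.1 (hu.mem p hp).1
  have hdet : ∀ p ∈ O₁, ∀ z, IsUnit (E p z).det := fun p hp z =>
    KW.isUnit_det_of_trivialization hopen hconn hzero hu.smooth hE hp z
  have hdiff : ∀ p ∈ O₁, Differentiable ℂ (E p) := fun p hp =>
    KW.differentiable_of_trivialization hopen hconn hzero hu.smooth hE hp
  have hsymm : ∀ p ∈ O₁, ∀ j : ℕ, E p (KW.root n ^ j * k) * (KW.tau n)⁻¹ ^ j =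
      (KW.tau n)⁻¹ ^ j * E p k := fun p hp j =>
    KW.trivialization_root_pow_mul hopen hconn hzero hu.smooth hτ hE hp k j
  have hvt' : vt = KW.backVec E k v := hvt
  have hYt' : Yt = KW.backY E k v := by rw [hYt, hvt']; rfl
  have hO' : O = KW.regularSet O₁ E k v := by rw [hO, hvt']; rfl
  have hY := KW.isBacklundSolution_backY (v := v) hopen hu.smooth hτ hE fun p hp => hdet p hp k
  have hOo : IsOpen O := by
    rw [hO']
    exact KW.isOpen_regularSet hopen hE fun p hp => hdet p hp k
  have hsub : O ⊆ O₁ := by rw [hO']; exact fun q hq => hq.1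
  rw [← hO', ← hYt'] at hY
  refine ⟨fun p hp => hdet p hp k, hOo, ?_, hut ▸ hY.isSolution_transform hOo (hu.mono hsub),
    ⟨KW.dressE E k v, ?_, ?_, ?_, ?_⟩, hY⟩
  · rw [hO]
    refine ⟨hzero, ?_⟩
    rw [hvt]
    simpa only [hE.normalized, inv_one, Matrix.one_mulVec] using hv
  · rw [hut, hYt', hO']
    exact KW.isTrivialization_dressE hopen hu.smooth hE hdet hdiff hτ hsymm hzero hv
  · exact fun p hp => KW.differentiable_dressE (hdiff p (hsub hp))
  · intro p hp z
    rw [hO'] at hp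
    exact KW.isUnit_det_dressE hv (hdiff p hp.1) (hdet p hp.1) hp.2 (hsymm p hp.1) z
  · intro p hp z hz
    rw [hO'] at hp
    rw [hvt']
    exact KW.dressE_eq hv (hdet p hp.1 k) hp.2 (hsymm p hp.1) hz
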